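/- **Setting.** Let $U$ be a compact metric space, $Y\subset\mathbb R^m$ and $Z\subset\mathbb R^n$ compact sets, and let $f,g,G$ be continuous functions on $U\times\mathbb R^m\times\mathbb R^n$ with values in $\mathbb R^m,\mathbb R^n,\mathbb R$. Let $f$ and $g$ be Lipschitz in $(y,z)\in Y\times Z$ uniformly in $u$, and let $f$ be also Lipschitz in $u$ uniformly in $(y,z)\in Y\times Z$. Spaces $\mathcal P(X)$ of Borel probability measures on a compact metric space $X$ carry a metric $\rho$ consistent with weak convergence. All solutions of differential equations are absolutely continuous and satisfy the equation almost everywhere on $[0,\infty)$; controls are measurable. A measurable function $x:[0,\infty)\to X$ generates the occupational measure $\nu\in\mathcal P(X)$ if $\frac1T\int_0^T h(x(t))\,dt\to\int h\,d\nu$ as $T\to\infty$ for all $h\in C(X)$. For $z\in Z$, a pair $(u(\cdot),y(\cdot))$ with values in $U\times Y$ is admissible for the associated system if $y'=f(u,y,z)$. Put $$W(z)=\{\mu\in\mathcal P(U\times Y):\textstyle\int\nabla\phi(y)^Tf(u,y,z)\,d\mu=0\ \forall\phi\in C^1(\mathbb R^m)\},\qquad F=\{(\mu,z):z\in Z,\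 \mu\in W(z)\},$$ $\tilde g(\mu,z)=\int g(u,y,z)\,\mu(du,dy)$ and $\tilde G(\mu,z)=\int G(u,y,z)\,\mu(du,dy)$. A pair $(\mu(\cdot),z(\cdot))$, with $\mu(\cdot)$ measurable and $z(t)\in Z$ for all $t\ge0$, is admissible for the averaged system if $z'(t)=\tilde g(\mu(t),z(t))$ and $\mu(t)\in W(z(t))$ for a.e. $t\ge 0$. Let $\tilde V^*$ be the infimum of $\liminf_{T\to\infty}\frac1T\int_0^T\tilde G(\mu(t),z(t))\,dt$ over admissible pairs of the averaged system, let $$\tilde{\mathcal W}=\{p\in\mathcal P(F):\textstyle\int\nabla\psi(z)^T\tilde g(\mu,z)\,dp=0\ \forall\psi\in C^1(\mathbb R^n)\},$$ and let $\tilde G^*=\min_{p\in\tilde{\mathcal W}}\int\tilde G\,dp$ (the averaged IDLP problem). *ACG families.* Let $(u_z(\cdot),y_z(\cdot))$, $z\in Z$, be admissible for the associated system (with this $z$), let it generate the occupational measure $\mu(\cdot|z)$, with $z\mapsto\int h(u,y,z)\,\mu(du,dy|z)$ measurable and $\frac1S\int_0^Sh(u_z,y_z,z)\,d\tau\to\int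 h(u,y,z)\,\mu(du,dy|z)$ uniformly in $z\in Z$ for every $h\in C(U\times Y\times Z)$. The family is average control generating (ACG) for the initial state $z_0$ if $z'=\tilde g(\mu(\cdot|z),z)$, $z(0)=z_0$ has a unique solution $z(\cdot)$ in $Z$ on $[0,\infty)$ and $\lim_{T\to\infty}\frac1T\int_0^T\tilde h(\mu(\cdot|z(t)),z(t))\,dt$ exists for every continuous $\tilde h$ on $F$. It is $\alpha$-near optimal ($\alpha>0$) if moreover this limit with $\tilde h=\tilde G$ is at most $\tilde V^*+\alpha$. *Approximating problems.* Let $\psi_i\in C^1(\mathbb R^n)$ and $\phi_i\in C^1(\mathbb R^m)$, $i\ge1$, be such that every $C^1$ function and its gradient are simultaneously approximated, uniformly on $Z$ (respectively $Y$), by linear combinations of the $\psi_i$ (respectively $\phi_i$) and of their gradients. For $N,M\ge1$ let $W_M(z)$, $F_M$ be defined as $W(z)$, $F$ with the test functions $\phi_1,\dots,\phi_M$ only, let $\tilde{\mathcal W}^{N,M}$ be the set of $p\in\mathcal P(F_M)$ with $\int\nabla\psi_i(z)^T\tilde g\,dp=0$ for $i\le N$, and let $\tilde G^{N,M}=\min_{p\in\tilde{\mathcal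 W}^{N,M}}\int\tilde G\,dp$. Suppose that for all $N,M$ there are $\zeta^{N,M}\in\mathrm{span}(\psi_1,\dots,\psi_N)$ with $\tilde G^{N,M}\le\tilde G(\mu,z)+\nabla\zeta^{N,M}(z)^T\tilde g(\mu,z)$ on $F_M$, and, for every $z\in Z$, $\eta^{N,M}_z\in\mathrm{span}(\phi_1,\dots,\phi_M)$ that attains the maximum over $\eta$ in this span of $\min_{(u,y)\in U\times Y}\{G+\nabla\zeta^{N,M}(z)^Tg+\nabla\eta(y)^Tf\}(u,y,z)$. For $(y,z)\in Y\times Z$ let $u^{N,M}(y,z)$ be a minimizer over $u\in U$ of $$G(u,y,z)+\nabla\zeta^{N,M}(z)^Tg(u,y,z)+\nabla\eta_z^{N,M}(y)^Tf(u,y,z),\tag{1}$$ and suppose that for all $z\in Z$ and $y_0\in Y$ the closed-loop system $y'=f(u^{N,M}(y,z),y,z)$, $y(0)=y_0$, has a unique solution in $Y$ on $[0,\infty)$. Fix initial states $y_0^{N,M}(z)\in Y$, let $y_z^{N,M}(\cdot)$ be the corresponding solutions, and let $u_z^{N,M}(\tau)=u^{N,M}(y_z^{N,M}(\tau),z)$.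 **Assumptions.** Everything said to be independent of $N,M$ below is uniform over all $N,M\ge1$. 1. (i) The averaged IDLP problem has a unique optimal solution $p^*$, and $\tilde V^*=\tilde G^*$. (ii) There is an optimal admissible pair $(\mu^*(\cdot),z^*(\cdot))$ of the averaged problem, and $\lim_{T\to\infty}\frac1T\int_0^T\tilde h(\mu^*(t),z^*(t))\,dt$ exists for every continuous $\tilde h$ on $F$. (iii) For a.e. $t\ge0$ and all $r>0$, $p^*\{(\mu,z):\rho(\mu,\mu^*(t))+\|z-z^*(t)\|<r\}>0$. 2. For a.e. $t\ge0$, $\mu^*(t)$ is the occupational measure generated by an admissible pair $(u_t^*(\cdot),y_t^*(\cdot))$ of the associated system with $z=z^*(t)$, and for a.e. $\tau\ge0$ every ball around $(u_t^*(\tau),y_t^*(\tau))$ has positive $\mu^*(t)$-measure. 3. (i) There are neighbourhoods $O^{N,M}$ in $Z$ of the set $\{z^*(t):t\ge0\}$ such that, for all $z_0\in O^{N,M}$, $(u_z^{N,M},y_z^{N,M})$ is an ACG family for the initial state $z_0$. Let $\mu^{N,M}(z)$ be the occupational measures that it generates. For each $h\in C(U\times Y\times Z)$ there is $\phi_h(S)\to0$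 ($S\to\infty$), independent of $N,M$ and $z$, with $$\Big|\frac1S\int_0^Sh(u_z^{N,M}(\tau),y_z^{N,M}(\tau),z)\,d\tau-\int h(u,y,z)\,\mu^{N,M}(z)(du,dy)\Big|\le\phi_h(S)\quad\forall z\in Z,\ S>0.$$ For a.e. $t$ and $z=z^*(t)$, the closed-loop solutions that start at any $y$ in some neighbourhood (which may depend on $N,M,t$) of $\{y_t^*(\tau):\tau\ge0\}$ in $Y$ generate the same measure $\mu^{N,M}(z^*(t))$ and satisfy the same estimate. (ii) For $z_0\in O^{N,M}$ let $z^{N,M}(\cdot)$ be the solution of $z'=\tilde g(\mu^{N,M}(z),z)$, $z(0)=z_0$. The pair $(\mu^{N,M}(z^{N,M}(\cdot)),z^{N,M}(\cdot))$ generates an occupational measure $\lambda^{N,M}$, the same for all $z_0\in O^{N,M}$, and for each continuous $\tilde h$ there is $\phi_{\tilde h}(T)\to0$ ($T\to\infty$), independent of $N,M$ and $z_0$, with $|\frac1T\int_0^T\tilde h(\mu^{N,M}(z^{N,M}(t)),z^{N,M}(t))\,dt-\int\tilde h\,d\lambda^{N,M}|\le\phi_{\tilde h}(T)$ for all $T>0$.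 4. For a.e. $t\ge0$ there is an open ball $Q_t$ centered at $z^*(t)$, independent of $N,M$, such that: (i) for $z',z''\in Q_t\cap Z$, $\rho(\mu^{N,M}(z'),\mu^{N,M}(z''))\le\kappa(\|z'-z''\|)$ with $\kappa(\theta)\to0$ as $\theta\to0$ ($\kappa$ independent of $N,M$), and $\|\tilde g(\mu^{N,M}(z'),z')-\tilde g(\mu^{N,M}(z''),z'')\|\le L\|z'-z''\|$ with $L$ independent of $N,M,t$; (ii) for the solution $z^{N,M}$ with $z^{N,M}(0)=z^*(0)$ and every $t>0$, $\lim_{N\to\infty}\limsup_{M\to\infty}\mathrm{meas}\{t'\in[0,t]:z^{N,M}(t')\notin Q_{t'}\}=0$. 5. For a.e. $t$ with $Q_t\ne\emptyset$: (i) for a.e. $\tau\ge0$ there is an open ball $B_{t,\tau}$ centered at $y_t^*(\tau)$, independent of $N,M$, such that (1) has a unique minimizer for $(y,z)\in (B_{t,\tau}\cap Y)\times(Q_t\cap Z)$; (ii) on this set $u^{N,M}$ is Lipschitz with a constant independent of $N,M,\tau$; (iii) for the closed-loop solution $y_t^{N,M}$ with $z=z^*(t)$, $y_t^{N,M}(0)=y_t^*(0)$,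 and every $\tau>0$, $\lim_{N\to\infty}\limsup_{M\to\infty}\mathrm{meas}\{\tau'\in[0,\tau]:y_t^{N,M}(\tau')\notin B_{t,\tau'}\}=0$. **Theorem.** Under these assumptions there are $\beta(N,M)>0$ such that, for all $N,M\ge1$ (and every initial state $z_0\in O^{N,M}$, in particular $z_0=z^*(0)$), $(u_z^{N,M},y_z^{N,M})$ is a $\beta(N,M)$-near optimal ACG family, and $$\lim_{N\to\infty}\limsup_{M\to\infty}\beta(N,M)=0.$$ Moreover, $\lim_{N\to\infty}\limsup_{M\to\infty}\rho(\lambda^{N,M},p^*)=0$. -/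

import Mathlib

open MeasureTheory Filter Set Topology

noncomputable section

namespace SPAveraging

/-! ### Probability measures on a compact metrizable space -/

instance instSecondCountableProbabilityMeasure (X : Type*) [TopologicalSpace X] [CompactSpace X]
    [TopologicalSpace.MetrizableSpace X] [SecondCountableTopology X]
    [MeasurableSpace X] [BorelSpace X] :
    SecondCountableTopology (ProbabilityMeasure X) := by
  let _ : MetricSpace (ProbabilityMeasure X) :=
    TopologicalSpace.metrizableSpaceMetric (ProbabilityMeasure X)
  infer_instance

/-- The sets that are open for weak convergence belong to the standard sigma-algebra of the space of
probability measures, so that one can speak of Borel measures on that space. -/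
instance instOpensMeasurableProbabilityMeasure (X : Type*) [TopologicalSpace X] [CompactSpace X]
    [TopologicalSpace.MetrizableSpace X] [SecondCountableTopology X]
    [MeasurableSpace X] [BorelSpace X] :
    OpensMeasurableSpace (ProbabilityMeasure X) := by
  have h2 := instSecondCountableProbabilityMeasure X
  have hind : (inferInstance : TopologicalSpace (ProbabilityMeasure X)) =
      ⨅ f : BoundedContinuousFunction X NNReal, TopologicalSpace.induced
        (fun μ : ProbabilityMeasure X => (∫⁻ x, f x ∂(μ : Measure X)).toNNReal) inferInstance := by
    have h3 : Topology.IsInducing (fun μ : ProbabilityMeasure X =>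
        fun f : BoundedContinuousFunction X NNReal => (∫⁻ x, f x ∂(μ : Measure X)).toNNReal) := by
      rw [Topology.isInducing_iff_nhds]
      intro μ
      apply le_antisymm
      · rw [← Filter.tendsto_iff_comap]
        rw [tendsto_pi_nhds]
        intro f
        exact (ProbabilityMeasure.continuous_testAgainstNN_eval f).continuousAt
      · have : Tendsto id (comap (fun μ : ProbabilityMeasure X =>
          fun f : BoundedContinuousFunction X NNReal => (∫⁻ x, f x ∂(μ : Measure X)).toNNReal)
            (𝓝 (fun f => (∫⁻ x, f x ∂(μ : Measure X)).toNNReal))) (𝓝 μ) := by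
          rw [ProbabilityMeasure.tendsto_nhds_iff_toFiniteMeasure_tendsto_nhds,
            FiniteMeasure.tendsto_iff_forall_testAgainstNN_tendsto]
          intro f
          have := (tendsto_pi_nhds.1 (tendsto_comap (f := (fun μ : ProbabilityMeasure X =>
            fun f : BoundedContinuousFunction X NNReal => (∫⁻ x, f x ∂(μ : Measure X)).toNNReal))
            (x := 𝓝 (fun f => (∫⁻ x, f x ∂(μ : Measure X)).toNNReal)))) f
          exact this
        exact this
    rw [h3.eq_induced, Pi.topologicalSpace, induced_iInf]
    simp only [induced_compose]
    rfl
  constructor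
  rw [borel_eq_generateFrom_of_subbasis
    (hind.trans (generateFrom_iUnion_isOpen _).symm)]
  refine MeasurableSpace.generateFrom_le ?_
  intro s hs
  obtain ⟨f, hf⟩ := mem_iUnion.1 hs
  obtain ⟨O, hO, rfl⟩ := isOpen_induced_iff.1 hf
  refine Measurable.ennreal_toNNReal ?_ hO.measurableSet
  have hf : Measurable (fun x => ((f x : NNReal) : ENNReal)) := by
    fun_prop
  exact (Measure.measurable_lintegral hf).comp measurable_subtype_coe

/-- `ρ` is a metric on `X` that is consistent with the topology of `X` (for spaces of probability
measures: with weak convergence). -/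
structure IsConsistentMetric {X : Type*} [TopologicalSpace X] (ρ : X → X → ℝ) : Prop where
  eq_zero_iff : ∀ a b, ρ a b = 0 ↔ a = b
  symm : ∀ a b, ρ a b = ρ b a
  triangle : ∀ a b c, ρ a c ≤ ρ a b + ρ b c
  tendsto_iff : ∀ (x : ℕ → X) (a : X),
    Tendsto x atTop (𝓝 a) ↔ Tendsto (fun k => ρ (x k) a) atTop (𝓝 0)

/-- `lim_{N → ∞} limsup_{M → ∞} a N M = 0`, with `N, M = 1, 2, …`. -/
def IterLimZero (a : ℕ+ → ℕ+ → EReal) : Prop :=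
  Tendsto (fun N => limsup (fun M => a N M) atTop) atTop (𝓝 0)

/-! ### Time averages, occupational measures, solutions of differential equations -/

/-- Lebesgue measure on the time half-line `[0, ∞)`. -/
abbrev timeMeasure : Measure ℝ := volume.restrict (Ici 0)

/-- The average of `h` over `[0, T]`. -/
def timeAvg (h : ℝ → ℝ) (T : ℝ) : ℝ := T⁻¹ * ∫ t in (0 : ℝ)..T, h t

/-- `ν` is the occupational measure generated by the measurable function `x` on `[0, ∞)`. -/
structure IsOccupationalMeasure {X : Type*} [TopologicalSpace X] [MeasurableSpace X]
    (x : ℝ → X) (ν : ProbabilityMeasure X) : Prop where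
  aemeasurable : AEMeasurable x timeMeasure
  tendsto : ∀ h : C(X, ℝ),
    Tendsto (timeAvg fun t => h (x t)) atTop (𝓝 (∫ a, h a ∂(ν : Measure X)))

/-- `x` is absolutely continuous on every `[0, T]` and `x'(t) = v t` for almost all `t ≥ 0`. -/
structure IsSolution {E : Type*} [NormedAddCommGroup E] [NormedSpace ℝ E]
    (x v : ℝ → E) : Prop where
  absCont : ∀ T : ℝ, 0 < T → AbsolutelyContinuousOnInterval x 0 T
  ode : ∀ᵐ t ∂timeMeasure, HasDerivAt x (v t) t

/-- Every `C¹` function is, together with its gradient, approximated uniformly on `K` by linear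
combinations of the `C¹` functions `χ 0, χ 1, …`, respectively of their gradients. -/
structure ApproximatesC1 {d : ℕ} (χ : ℕ → EuclideanSpace ℝ (Fin d) → ℝ)
    (K : Set (EuclideanSpace ℝ (Fin d))) : Prop where
  contDiff : ∀ i, ContDiff ℝ 1 (χ i)
  approx : ∀ h : EuclideanSpace ℝ (Fin d) → ℝ, ContDiff ℝ 1 h → ∀ ε > 0,
    ∃ (k : ℕ) (c : ℕ → ℝ), ∀ x ∈ K,
      |h x - ∑ i ∈ Finset.range k, c i * χ i x| < ε ∧
      ‖fderiv ℝ h x - ∑ i ∈ Finset.range k, c i • fderiv ℝ (χ i) x‖ < ε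

/-- `h` is a linear combination of the first `k` functions of the sequence `χ`. -/
def InSpan {d : ℕ} (χ : ℕ → EuclideanSpace ℝ (Fin d) → ℝ) (k : ℕ)
    (h : EuclideanSpace ℝ (Fin d) → ℝ) : Prop :=
  ∃ c : ℕ → ℝ, h = fun x => ∑ i ∈ Finset.range k, c i * χ i x

/-! ### The singularly perturbed system and the averaged problem -/

/-- The data of the singularly perturbed problem
`ε y' = f(u, y, z)`, `z' = g(u, y, z)`, `u ∈ U`, `y ∈ Y ⊆ ℝᵐ`, `z ∈ Z ⊆ ℝⁿ`, running cost `G`. -/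
structure SPSystem (U : Type*) [MetricSpace U] (m n : ℕ) where
  Y : Set (EuclideanSpace ℝ (Fin m))
  Z : Set (EuclideanSpace ℝ (Fin n))
  f : U → EuclideanSpace ℝ (Fin m) → EuclideanSpace ℝ (Fin n) → EuclideanSpace ℝ (Fin m)
  g : U → EuclideanSpace ℝ (Fin m) → EuclideanSpace ℝ (Fin n) → EuclideanSpace ℝ (Fin n)
  G : U → EuclideanSpace ℝ (Fin m) → EuclideanSpace ℝ (Fin n) → ℝ
  isCompact_Y : IsCompact Y
  isCompact_Z : IsCompact Z
  continuous_f : Continuous fun p : U × EuclideanSpace ℝ (Fin m) × EuclideanSpace ℝ (Fin n) =>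
    f p.1 p.2.1 p.2.2
  continuous_g : Continuous fun p : U × EuclideanSpace ℝ (Fin m) × EuclideanSpace ℝ (Fin n) =>
    g p.1 p.2.1 p.2.2
  continuous_G : Continuous fun p : U × EuclideanSpace ℝ (Fin m) × EuclideanSpace ℝ (Fin n) =>
    G p.1 p.2.1 p.2.2
  lipschitz_f : ∃ L : ℝ, ∀ u, ∀ y ∈ Y, ∀ y' ∈ Y, ∀ z ∈ Z, ∀ z' ∈ Z,
    ‖f u y z - f u y' z'‖ ≤ L * (‖y - y'‖ + ‖z - z'‖)
  lipschitz_g : ∃ L : ℝ, ∀ u, ∀ y ∈ Y, ∀ y' ∈ Y, ∀ z ∈ Z, ∀ z' ∈ Z,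
    ‖g u y z - g u y' z'‖ ≤ L * (‖y - y'‖ + ‖z - z'‖)

variable {U : Type*} [MetricSpace U] [CompactSpace U] [MeasurableSpace U] [BorelSpace U] {m n : ℕ}

instance (D : SPSystem U m n) : CompactSpace D.Y := isCompact_iff_compactSpace.mp D.isCompact_Y

instance (D : SPSystem U m n) : CompactSpace D.Z := isCompact_iff_compactSpace.mp D.isCompact_Z

namespace SPSystem

/-- The space `𝒫(U × Y)`, with weak convergence. -/
abbrev FastMeas (D : SPSystem U m n) : Type _ := ProbabilityMeasure (U × D.Y)

/-- The space `𝒫(𝒫(U × Y) × Z)`, with weak convergence. -/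
abbrev SlowMeas (D : SPSystem U m n) : Type _ := ProbabilityMeasure (D.FastMeas × D.Z)

variable (D : SPSystem U m n)

/-- `g̃(μ, z) = ∫ g(u, y, z) μ(du, dy)`. -/
def gTilde (μ : D.FastMeas) (z : D.Z) : EuclideanSpace ℝ (Fin n) :=
  ∫ x, D.g x.1 x.2 z ∂(μ : Measure (U × D.Y))

/-- `G̃(μ, z) = ∫ G(u, y, z) μ(du, dy)`. -/
def GTilde (μ : D.FastMeas) (z : D.Z) : ℝ :=
  ∫ x, D.G x.1 x.2 z ∂(μ : Measure (U × D.Y))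

/-- The set `W(z)` of probability measures `μ` on `U × Y` with
`∫ ∇φ(y)ᵀ f(u, y, z) μ(du, dy) = 0` for all `φ ∈ C¹(ℝᵐ)`. -/
def W (z : D.Z) : Set D.FastMeas :=
  {μ | ∀ φ : EuclideanSpace ℝ (Fin m) → ℝ, ContDiff ℝ 1 φ →
    ∫ x, fderiv ℝ φ x.2 (D.f x.1 x.2 z) ∂(μ : Measure (U × D.Y)) = 0}

/-- The graph `F` of `W`. -/
def graphW : Set (D.FastMeas × D.Z) := {q | q.1 ∈ D.W q.2}

/-- The set `𝒲̃` of probability measures `p` on `F` (regarded as measures on `𝒫(U × Y) × Z` carried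
by `F`) with `∫ ∇ψ(z)ᵀ g̃(μ, z) p(dμ, dz) = 0` for all `ψ ∈ C¹(ℝⁿ)`. -/
def tildeW : Set D.SlowMeas :=
  {p | p D.graphW = 1 ∧ ∀ ψ : EuclideanSpace ℝ (Fin n) → ℝ, ContDiff ℝ 1 ψ →
    ∫ q, fderiv ℝ ψ q.2 (D.gTilde q.1 q.2) ∂(p : Measure (D.FastMeas × D.Z)) = 0}

/-- The objective `∫ G̃(μ, z) p(dμ, dz)`. -/
def cost (p : D.SlowMeas) : ℝ := ∫ q, D.GTilde q.1 q.2 ∂(p : Measure (D.FastMeas × D.Z))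

/-- The optimal value `G̃*` of the averaged IDLP problem. -/
def GStar : ℝ := sInf (D.cost '' D.tildeW)

/-- `(u, y)` is admissible for the associated system `y' = f(u, y, z)` with fixed `z`. -/
structure AdmissibleAssoc (z : D.Z) (u : ℝ → U) (y : ℝ → D.Y) : Prop where
  aemeasurable : AEMeasurable u timeMeasure
  solution : IsSolution (fun τ => (y τ : EuclideanSpace ℝ (Fin m)))
    (fun τ => D.f (u τ) (y τ) z)

/-- `(μ, z)` is admissible for the averaged system `z' = g̃(μ, z)`, `μ ∈ W(z)`. -/
structure AdmissibleAvg (μ : ℝ → D.FastMeas) (z : ℝ → D.Z) : Prop where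
  aemeasurable : AEMeasurable μ timeMeasure
  solution : IsSolution (fun t => (z t : EuclideanSpace ℝ (Fin n)))
    (fun t => D.gTilde (μ t) (z t))
  mem_W : ∀ᵐ t ∂timeMeasure, μ t ∈ D.W (z t)

/-- `liminf_{T → ∞} (1/T) ∫₀ᵀ G̃(μ(t), z(t)) dt`. -/
def avgCost (μ : ℝ → D.FastMeas) (z : ℝ → D.Z) : ℝ :=
  liminf (timeAvg fun t => D.GTilde (μ t) (z t)) atTop

/-- The optimal value `Ṽ*` of the averaged optimal control problem. -/
def VStar : ℝ :=
  sInf {v | ∃ (μ : ℝ → D.FastMeas) (z : ℝ → D.Z), D.AdmissibleAvg μ z ∧ v = D.avgCost μ z}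

/-! ### Average control generating families -/

/-- `z` solves `z' = g̃(μ(·|z), z)`, `z(0) = z₀`, and stays in `Z`. -/
structure IsAvgTrajectory (μ : D.Z → D.FastMeas) (z₀ : D.Z) (z : ℝ → D.Z) : Prop where
  init : z 0 = z₀
  solution : IsSolution (fun t => (z t : EuclideanSpace ℝ (Fin n)))
    (fun t => D.gTilde (μ (z t)) (z t))

/-- `(u_z, y_z)`, `z ∈ Z`, is an average control generating (ACG) family for the initial condition
`z₀`; `μ z = μ(du, dy | z)` are the occupational measures it generates and `zt` is the trajectory of
the averaged system it generates. -/
structure IsACG (z₀ : D.Z) (u : D.Z → ℝ → U) (y : D.Z → ℝ → D.Y) (μ : D.Z → D.FastMeas)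
    (zt : ℝ → D.Z) : Prop where
  admissible : ∀ z, D.AdmissibleAssoc z (u z) (y z)
  occupational : ∀ z, IsOccupationalMeasure (fun τ => (u z τ, y z τ)) (μ z)
  measurable : ∀ h : C(U × D.Y × D.Z, ℝ),
    Measurable fun z => ∫ x, h (x.1, x.2, z) ∂(μ z : Measure (U × D.Y))
  uniform : ∀ h : C(U × D.Y × D.Z, ℝ), ∃ φ : ℝ → ℝ, Tendsto φ atTop (𝓝 0) ∧
    ∀ z, ∀ S > 0, |timeAvg (fun τ => h (u z τ, y z τ, z)) S
      - ∫ x, h (x.1, x.2, z) ∂(μ z : Measure (U × D.Y))| ≤ φ S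
  trajectory : D.IsAvgTrajectory μ z₀ zt
  unique : ∀ z', D.IsAvgTrajectory μ z₀ z' → ∀ t, 0 ≤ t → z' t = zt t
  limits : ∀ h : C(D.FastMeas × D.Z, ℝ), ∃ l : ℝ,
    Tendsto (timeAvg fun t => h (μ (zt t), zt t)) atTop (𝓝 l)

/-- The ACG family is `α`-near optimal, `α > 0`. -/
structure IsNearOptimalACG (α : ℝ) (z₀ : D.Z) (u : D.Z → ℝ → U) (y : D.Z → ℝ → D.Y)
    (μ : D.Z → D.FastMeas) (zt : ℝ → D.Z) : Prop where
  pos : 0 < α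
  acg : D.IsACG z₀ u y μ zt
  near : ∃ l : ℝ, Tendsto (timeAvg fun t => D.GTilde (μ (zt t)) (zt t)) atTop (𝓝 l) ∧
    l ≤ D.VStar + α

/-! ### The `(N, M)`-approximating problems -/

/-- `W_M(z)`: only the test functions `φ_1, …, φ_M` are used. -/
def WM (φ : ℕ → EuclideanSpace ℝ (Fin m) → ℝ) (M : ℕ) (z : D.Z) : Set D.FastMeas :=
  {μ | ∀ i < M, ∫ x, fderiv ℝ (φ i) x.2 (D.f x.1 x.2 z) ∂(μ : Measure (U × D.Y)) = 0}

/-- The graph `F_M` of `W_M`. -/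
def graphWM (φ : ℕ → EuclideanSpace ℝ (Fin m) → ℝ) (M : ℕ) : Set (D.FastMeas × D.Z) :=
  {q | q.1 ∈ D.WM φ M q.2}

/-- `𝒲̃^{N,M}`. -/
def tildeWNM (ψ : ℕ → EuclideanSpace ℝ (Fin n) → ℝ) (φ : ℕ → EuclideanSpace ℝ (Fin m) → ℝ)
    (N M : ℕ) : Set D.SlowMeas :=
  {p | p (D.graphWM φ M) = 1 ∧ ∀ i < N,
    ∫ q, fderiv ℝ (ψ i) q.2 (D.gTilde q.1 q.2) ∂(p : Measure (D.FastMeas × D.Z)) = 0}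

/-- The optimal value `G̃^{N,M}` of the `(N, M)`-approximating averaged problem. -/
def GNM (ψ : ℕ → EuclideanSpace ℝ (Fin n) → ℝ) (φ : ℕ → EuclideanSpace ℝ (Fin m) → ℝ)
    (N M : ℕ) : ℝ := sInf (D.cost '' D.tildeWNM ψ φ N M)

/-- `ζ` is a solution of the `(N, M)`-approximating averaged dual problem. -/
structure IsAvgDualSol (ψ : ℕ → EuclideanSpace ℝ (Fin n) → ℝ)
    (φ : ℕ → EuclideanSpace ℝ (Fin m) → ℝ) (N M : ℕ)
    (ζ : EuclideanSpace ℝ (Fin n) → ℝ) : Prop where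
  mem : InSpan ψ N ζ
  le : ∀ q ∈ D.graphWM φ M,
    D.GNM ψ φ N M ≤ D.GTilde q.1 q.2 + fderiv ℝ ζ q.2 (D.gTilde q.1 q.2)

/-- `G(u, y, z) + ∇ζ(z)ᵀ g(u, y, z) + ∇η(y)ᵀ f(u, y, z)`. -/
def augCost (ζ : EuclideanSpace ℝ (Fin n) → ℝ) (η : EuclideanSpace ℝ (Fin m) → ℝ)
    (u : U) (y : D.Y) (z : D.Z) : ℝ :=
  D.G u y z + fderiv ℝ ζ z (D.g u y z) + fderiv ℝ η y (D.f u y z)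

/-- `η` is a solution of the `(N, M)`-approximating associated dual problem at `z` (built from `ζ`);
`σ` is the optimal value of that problem. -/
structure IsAssocDualSol (φ : ℕ → EuclideanSpace ℝ (Fin m) → ℝ) (M : ℕ)
    (ζ : EuclideanSpace ℝ (Fin n) → ℝ) (z : D.Z) (η : EuclideanSpace ℝ (Fin m) → ℝ) : Prop where
  mem : InSpan φ M η
  le : ∃ σ : ℝ,
    IsLUB {θ : ℝ | ∃ η', InSpan φ M η' ∧ ∀ u y, θ ≤ D.augCost ζ η' u y z} σ ∧
    ∀ u y, σ ≤ D.augCost ζ η u y z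

/-- `y` is a solution in `Y` of the closed-loop system `y' = f(v(y, z), y, z)`, `y(0) = y₀`. -/
structure IsClosedLoop (v : D.Y → D.Z → U) (z : D.Z) (y₀ : D.Y) (y : ℝ → D.Y) : Prop where
  init : y 0 = y₀
  admissible : D.AdmissibleAssoc z (fun τ => v (y τ) z) y

/-- The test functions, solutions `ζ^{N,M}`, `η^{N,M}_z` of the approximating dual problems, the
feedback `u^{N,M}(y, z)` and the (unique) solutions of the closed-loop system. -/
structure Scheme where
  ψ : ℕ → EuclideanSpace ℝ (Fin n) → ℝ
  φ : ℕ → EuclideanSpace ℝ (Fin m) → ℝ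
  ζ : ℕ+ → ℕ+ → EuclideanSpace ℝ (Fin n) → ℝ
  η : ℕ+ → ℕ+ → D.Z → EuclideanSpace ℝ (Fin m) → ℝ
  /-- the feedback `u^{N,M}(y, z)` -/
  feedback : ℕ+ → ℕ+ → D.Y → D.Z → U
  /-- `traj N M z y₀` is the solution of the closed-loop system that starts at `y₀` -/
  traj : ℕ+ → ℕ+ → D.Z → D.Y → ℝ → D.Y
  approx_ψ : ApproximatesC1 ψ D.Z
  approx_φ : ApproximatesC1 φ D.Y
  ζ_sol : ∀ N M : ℕ+, D.IsAvgDualSol ψ φ N M (ζ N M)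
  η_sol : ∀ (N M : ℕ+) (z : D.Z), D.IsAssocDualSol φ M (ζ N M) z (η N M z)
  feedback_min : ∀ (N M : ℕ+) (y : D.Y) (z : D.Z) (v : U),
    D.augCost (ζ N M) (η N M z) (feedback N M y z) y z ≤ D.augCost (ζ N M) (η N M z) v y z
  traj_sol : ∀ N M z y₀, D.IsClosedLoop (feedback N M) z y₀ (traj N M z y₀)
  traj_unique : ∀ N M z y₀ y, D.IsClosedLoop (feedback N M) z y₀ y →
    ∀ τ, 0 ≤ τ → y τ = traj N M z y₀ τ

/-! ### The assumptions on the optimal solution -/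

/-- The averaged IDLP problem has the unique optimal solution `pStar`, its value is `Ṽ*`, the pair
`(μStar, zStar)` is optimal in the averaged problem and has time averages, and its values lie in the
support of `pStar`. -/
structure OptimalPair (ρ : D.FastMeas → D.FastMeas → ℝ) (pStar : D.SlowMeas)
    (μStar : ℝ → D.FastMeas) (zStar : ℝ → D.Z) : Prop where
  p_mem : pStar ∈ D.tildeW
  p_opt : D.cost pStar = D.GStar
  p_unique : ∀ p ∈ D.tildeW, D.cost p = D.GStar → p = pStar
  values_eq : D.VStar = D.GStar
  admissible : D.AdmissibleAvg μStar zStar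
  optimal : D.avgCost μStar zStar = D.VStar
  limits : ∀ h : C(D.FastMeas × D.Z, ℝ), ∃ l : ℝ,
    Tendsto (timeAvg fun t => h (μStar t, zStar t)) atTop (𝓝 l)
  support : ∀ᵐ t ∂timeMeasure, ∀ r > 0,
    0 < pStar {q | ρ q.1 (μStar t) + dist q.2 (zStar t) < r}

/-- For almost all `t`, `μStar t` is generated by an admissible pair `(uStar t, yStar t)` of the
associated system with `z = zStar t`, whose values lie in the support of `μStar t`. -/
structure OptimalFastPair (μStar : ℝ → D.FastMeas) (zStar : ℝ → D.Z)
    (uStar : ℝ → ℝ → U) (yStar : ℝ → ℝ → D.Y) : Prop where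
  admissible : ∀ᵐ t ∂timeMeasure, D.AdmissibleAssoc (zStar t) (uStar t) (yStar t)
  occupational : ∀ᵐ t ∂timeMeasure,
    IsOccupationalMeasure (fun τ => (uStar t τ, yStar t τ)) (μStar t)
  support : ∀ᵐ t ∂timeMeasure, ∀ᵐ τ ∂timeMeasure, ∀ r > 0,
    0 < μStar t {x | dist x.1 (uStar t τ) + dist x.2 (yStar t τ) < r}

namespace Scheme

variable {D} (S : D.Scheme)

/-- The member `y_z^{N,M}` of the family, `z ∈ Z`, with initial states `y₀ N M z`. -/
def fam (y₀ : ℕ+ → ℕ+ → D.Z → D.Y) (N M : ℕ+) (z : D.Z) : ℝ → D.Y := S.traj N M z (y₀ N M z)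

/-- The member `u_z^{N,M}` of the family. -/
def famControl (y₀ : ℕ+ → ℕ+ → D.Z → D.Y) (N M : ℕ+) (z : D.Z) : ℝ → U :=
  fun τ => S.feedback N M (S.fam y₀ N M z τ) z

/-- The family generated by the feedback is ACG with occupational measures `μ N M z`, which do not
depend on the initial state of the fast motion near `yStar t` (if `z = zStar t`); the pairs it
generates have the occupational measure `lam N M`, which does not depend on the initial state near
`zStar`; the time averages converge at rates `rate`, `slowRate` that do not depend on `N, M`.

`V N M t` is the neighbourhood of `yStar t`, and `O N M` is the neighbourhood of `zStar`;
`zNM N M z₀` is the trajectory of the averaged system that starts at `z₀`. -/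
structure GeneratesACG (zStar : ℝ → D.Z) (yStar : ℝ → ℝ → D.Y)
    (y₀ : ℕ+ → ℕ+ → D.Z → D.Y) (μ : ℕ+ → ℕ+ → D.Z → D.FastMeas)
    (zNM : ℕ+ → ℕ+ → D.Z → ℝ → D.Z) (lam : ℕ+ → ℕ+ → D.SlowMeas)
    (V : ℕ+ → ℕ+ → ℝ → Set D.Y) (O : ℕ+ → ℕ+ → Set D.Z)
    (rate : C(U × D.Y × D.Z, ℝ) → ℝ → ℝ) (slowRate : C(D.FastMeas × D.Z, ℝ) → ℝ → ℝ) :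
    Prop where
  mem_O : ∀ N M, ∀ t, 0 ≤ t → O N M ∈ 𝓝 (zStar t)
  acg : ∀ N M, ∀ z₀ ∈ O N M,
    D.IsACG z₀ (S.famControl y₀ N M) (S.fam y₀ N M) (μ N M) (zNM N M z₀)
  rate_tendsto : ∀ h, Tendsto (rate h) atTop (𝓝 0)
  rate_bound : ∀ h N M z, ∀ T > 0,
    |timeAvg (fun τ => h (S.famControl y₀ N M z τ, S.fam y₀ N M z τ, z)) T
      - ∫ x, h (x.1, x.2, z) ∂(μ N M z : Measure (U × D.Y))| ≤ rate h T
  indep : ∀ᵐ t ∂timeMeasure, ∀ N M,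
    (∀ τ, 0 ≤ τ → V N M t ∈ 𝓝 (yStar t τ)) ∧
    ∀ y ∈ V N M t,
      IsOccupationalMeasure (fun τ => (S.feedback N M (S.traj N M (zStar t) y τ) (zStar t),
        S.traj N M (zStar t) y τ)) (μ N M (zStar t)) ∧
      ∀ h, ∀ T > 0,
        |timeAvg (fun τ => h (S.feedback N M (S.traj N M (zStar t) y τ) (zStar t),
            S.traj N M (zStar t) y τ, zStar t)) T
          - ∫ x, h (x.1, x.2, zStar t) ∂(μ N M (zStar t) : Measure (U × D.Y))| ≤ rate h T
  slow_occupational : ∀ N M, ∀ z₀ ∈ O N M,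
    IsOccupationalMeasure (fun t => (μ N M (zNM N M z₀ t), zNM N M z₀ t)) (lam N M)
  slowRate_tendsto : ∀ h, Tendsto (slowRate h) atTop (𝓝 0)
  slowRate_bound : ∀ h N M, ∀ z₀ ∈ O N M, ∀ T > 0,
    |timeAvg (fun t => h (μ N M (zNM N M z₀ t), zNM N M z₀ t)) T
      - ∫ q, h q ∂(lam N M : Measure (D.FastMeas × D.Z))| ≤ slowRate h T

end Scheme

/-- Regularity of the occupational measures `μ N M z` in `z` on the balls `Q_t` of radius `rQ t`
around `zStar t`, and the condition that the trajectory `zNM N M` that starts at `zStar 0` leaves the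
balls only on small sets of times. The continuity modulus `κ` and the Lipschitz constant `L` do not
depend on `N, M`. -/
structure SlowRegularity (ρ : D.FastMeas → D.FastMeas → ℝ) (zStar : ℝ → D.Z)
    (μ : ℕ+ → ℕ+ → D.Z → D.FastMeas) (zNM : ℕ+ → ℕ+ → D.Z → ℝ → D.Z) (rQ : ℝ → ℝ) :
    Prop where
  pos : ∀ᵐ t ∂timeMeasure, 0 < rQ t
  continuity : ∀ᵐ t ∂timeMeasure, ∃ κ : ℝ → ℝ, Tendsto κ (𝓝[>] 0) (𝓝 0) ∧
    ∀ N M, ∀ z' ∈ Metric.ball (zStar t) (rQ t), ∀ z'' ∈ Metric.ball (zStar t) (rQ t),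
      ρ (μ N M z') (μ N M z'') ≤ κ (dist z' z'')
  lipschitz : ∃ L : ℝ, ∀ᵐ t ∂timeMeasure,
    ∀ N M, ∀ z' ∈ Metric.ball (zStar t) (rQ t), ∀ z'' ∈ Metric.ball (zStar t) (rQ t),
      ‖D.gTilde (μ N M z') z' - D.gTilde (μ N M z'') z''‖ ≤ L * dist z' z''
  small : ∀ t > 0, IterLimZero fun N M =>
    ((volume {t' | t' ∈ Icc 0 t ∧
      zNM N M (zStar 0) t' ∉ Metric.ball (zStar t') (rQ t')} : ENNReal) : EReal)

/-- For almost all `t` with `Q_t ≠ ∅`: on the balls `B_{t,τ}` of radius `rB t τ` around `yStar t τ`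
(times `Q_t`) the feedback is the unique minimizer and Lipschitz, with a constant that does not
depend on `N, M, τ`, and the closed-loop trajectory that starts at `yStar t 0` leaves the balls only
on small sets of times. -/
structure FastRegularity (S : D.Scheme) (zStar : ℝ → D.Z) (yStar : ℝ → ℝ → D.Y)
    (rQ : ℝ → ℝ) (rB : ℝ → ℝ → ℝ) : Prop where
  unique : ∀ᵐ t ∂timeMeasure, 0 < rQ t → ∀ᵐ τ ∂timeMeasure, 0 < rB t τ ∧
    ∀ N M, ∀ y ∈ Metric.ball (yStar t τ) (rB t τ), ∀ z ∈ Metric.ball (zStar t) (rQ t), ∀ v : U,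
      (∀ w, D.augCost (S.ζ N M) (S.η N M z) v y z ≤ D.augCost (S.ζ N M) (S.η N M z) w y z) →
      v = S.feedback N M y z
  lipschitz : ∀ᵐ t ∂timeMeasure, 0 < rQ t → ∃ L : ℝ, ∀ᵐ τ ∂timeMeasure, ∀ N M,
    ∀ y' ∈ Metric.ball (yStar t τ) (rB t τ), ∀ y'' ∈ Metric.ball (yStar t τ) (rB t τ),
    ∀ z' ∈ Metric.ball (zStar t) (rQ t), ∀ z'' ∈ Metric.ball (zStar t) (rQ t),
      dist (S.feedback N M y' z') (S.feedback N M y'' z'') ≤ L * (dist y' y'' + dist z' z'')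
  small : ∀ᵐ t ∂timeMeasure, 0 < rQ t → ∀ τ > 0, IterLimZero fun N M =>
    ((volume {τ' | τ' ∈ Icc 0 τ ∧
      S.traj N M (zStar t) (yStar t 0) τ' ∉ Metric.ball (yStar t τ') (rB t τ')} : ENNReal) : EReal)

end SPSystem

end SPAveraging

end

/-! Complementary slackness turns convergence of linear programs into convergence of feedbacks, and
Gronwall's inequality turns that into convergence of trajectories.

The feasible sets of the approximating programs are compact, decrease in both indices and intersect
in `tildeW`. As `pStar` is the only optimum of the limit program, approximate optima converge weakly
to it (`tendsto_of_mem_tildeWNM`). An open set charged by `pStar` is therefore eventually charged by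
the approximate optimum, hence contains some (μ, z) where the dual inequality for ζ is an equality
(`exists_mem_graphWM_eq`). In the same way, an open set charged by such a μ contains some (u, y)
where the augmented cost attains its minimum over U × Y, so that u minimizes (1) at (y, z)
(`exists_mem_forall_augCost_le`). The optimal pairs take values in the supports, so such points
exist arbitrarily close to them; uniqueness and the Lipschitz property of the minimizer then give
u^{N,M}(y*_t(τ), z*(t)) → u*_t(τ) (`Scheme.tendsto_feedback`).

Two perturbation arguments of the same kind follow, both based on
`tendsto_norm_sub_of_perturbation`. For almost every frozen t, the closed-loop solution from y*_t(0)
converges to y*_t, and since time averages converge at rates independent of N, M, the limits may be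
exchanged: μ^{N,M}(z*(t)) → μ*(t). On the slow scale this makes z^{N,M} converge to z*, and then
λ^{N,M} → p*, because the optimal pair generates `pStar` (`OptimalPair.isOccupationalMeasure`). The
cost is weakly continuous, so near optimality follows.

Iterated limits are expressed by the filter `iterFilter`. It has no countable base, so dominated
convergence along it needs its own proof (`tendsto_lintegral_iterFilter`). -/

set_option linter.unusedSectionVars false

/-! ### Borel structure and weak continuity for probability measures; iterated limits. -/

namespace SPAveraging

/-- By the portmanteau theorem, evaluation on a closed set is upper semicontinuous, and closed sets
form a generating π-system. -/
theorem measurable_of_continuous_probabilityMeasure {α X : Type*} [TopologicalSpace α]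
    [MeasurableSpace α] [OpensMeasurableSpace α] [TopologicalSpace X] [MeasurableSpace X]
    [BorelSpace X] [HasOuterApproxClosed X] {f : α → ProbabilityMeasure X} (hf : Continuous f) :
    Measurable f := by
  refine Measurable.subtype_mk (f := fun a => (f a : Measure X)) ?_
  refine Measurable.measure_of_isPiSystem_of_isProbabilityMeasure
    (BorelSpace.measurable_eq.trans borel_eq_generateFrom_isClosed) isPiSystem_isClosed ?_
  intro s hs
  refine measurable_of_Iio fun c => IsOpen.measurableSet ?_
  rw [isOpen_iff_mem_nhds]
  intro a ha
  exact eventually_lt_of_limsup_lt (lt_of_le_of_lt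
    (ProbabilityMeasure.limsup_measure_closed_le_of_tendsto (hf.tendsto a) hs) ha)

/-- The inclusion still missing comes from the previous lemma, applied to the identity with the
Borel σ-algebra on its source. -/
instance instBorelSpaceProbabilityMeasure (X : Type*) [TopologicalSpace X] [CompactSpace X]
    [TopologicalSpace.MetrizableSpace X] [SecondCountableTopology X]
    [MeasurableSpace X] [BorelSpace X] : BorelSpace (ProbabilityMeasure X) := by
  constructor
  refine le_antisymm (fun s hs => ?_) (OpensMeasurableSpace.borel_le (α := ProbabilityMeasure X))
  have h := @measurable_of_continuous_probabilityMeasure (ProbabilityMeasure X) X _ (borel _)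
    (@OpensMeasurableSpace.mk _ _ (borel _) le_rfl) _ _ _ _ id continuous_id
  exact h hs

/-- Lower semicontinuity on open sets; it lets positivity pass from a weak limit to the
approximating measures. -/
theorem isOpen_setOf_measure_pos {X : Type*} [TopologicalSpace X] [MeasurableSpace X]
    [OpensMeasurableSpace X] [HasOuterApproxClosed X] {A : Set X} (hA : IsOpen A) :
    IsOpen {p : ProbabilityMeasure X | 0 < (p : Measure X) A} := by
  rw [isOpen_iff_mem_nhds]
  intro p hp
  have h := ProbabilityMeasure.le_liminf_measure_open_of_tendsto (tendsto_id (x := 𝓝 p)) hA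
  have h' := eventually_lt_of_lt_liminf (lt_of_lt_of_le hp h)
  exact h'

/-- By compactness of X, the section of H at z varies continuously in the sup norm, and integration
against a probability measure is a contraction for that norm. This handles the change of z uniformly
in the measure. -/
theorem continuous_integral_prod {X Z : Type*} [TopologicalSpace X] [CompactSpace X]
    [MeasurableSpace X] [OpensMeasurableSpace X] [TopologicalSpace Z] {H : X → Z → ℝ}
    (hH : Continuous fun p : X × Z => H p.1 p.2) :
    Continuous fun q : ProbabilityMeasure X × Z => ∫ x, H x q.2 ∂(q.1 : Measure X) := by
  let Φ : C(Z, C(X, ℝ)) := ContinuousMap.curry ⟨fun p : Z × X => H p.2 p.1, by fun_prop⟩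
  rw [continuous_iff_continuousAt]
  rintro ⟨μ, z⟩
  have h1 : Tendsto (fun q : ProbabilityMeasure X × Z => ∫ x, H x z ∂(q.1 : Measure X)) (𝓝 (μ, z))
      (𝓝 (∫ x, H x z ∂(μ : Measure X))) :=
    ((ProbabilityMeasure.tendsto_iff_forall_integral_tendsto (F := 𝓝 (μ, z))).1
      (continuous_fst.tendsto (μ, z))) (BoundedContinuousFunction.mkOfCompact (Φ z))
  have h2 : Tendsto (fun q : ProbabilityMeasure X × Z => dist (Φ q.2) (Φ z)) (𝓝 (μ, z)) (𝓝 0) := by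
    have : Continuous fun q : ProbabilityMeasure X × Z => dist (Φ q.2) (Φ z) := by fun_prop
    have h := this.tendsto (μ, z)
    rwa [dist_self] at h
  have hint : ∀ (ν : ProbabilityMeasure X) w, Integrable (fun x => H x w) (ν : Measure X) :=
    fun _ w =>
      (Φ w).continuous.integrable_of_hasCompactSupport (HasCompactSupport.of_compactSpace _)
  refine tendsto_of_tendsto_of_dist h1 (squeeze_zero (fun _ => dist_nonneg) (fun q => ?_) h2)
  rw [dist_comm, Real.dist_eq, ← integral_sub (hint _ _) (hint _ _)]
  have h := norm_integral_le_of_norm_le_const (μ := (q.1 : Measure X))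
    (f := fun x => H x q.2 - H x z) (C := dist (Φ q.2) (Φ z)) (ae_of_all _ fun x =>
      ContinuousMap.dist_apply_le_dist (f := Φ q.2) (g := Φ z) x)
  rwa [probReal_univ, mul_one] at h

theorem continuous_integral_probabilityMeasure {X : Type*} [TopologicalSpace X]
    [MeasurableSpace X] [CompactSpace X] [OpensMeasurableSpace X] {h : X → ℝ}
    (hh : Continuous h) : Continuous fun μ : ProbabilityMeasure X => ∫ x, h x ∂(μ : Measure X) :=
  (continuous_integral_prod (Z := Unit) (H := fun x _ => h x) (by fun_prop)).comp
    (Continuous.prodMk_left ())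

/-- The filter of iterated limits: first the second index tends to infinity, then the first. -/
abbrev iterFilter : Filter (ℕ+ × ℕ+) := (atTop : Filter ℕ+).curry atTop

theorem iterFilter_le : iterFilter ≤ atTop ×ˢ atTop := curry_le_prod

theorem iterLimZero_iff {a : ℕ+ → ℕ+ → EReal} (ha : ∀ N M, 0 ≤ a N M) :
    IterLimZero a ↔ Tendsto (fun p : ℕ+ × ℕ+ => a p.1 p.2) iterFilter (𝓝 0) := by
  have h0 : ∀ N, 0 ≤ limsup (fun M => a N M) atTop := fun N =>
    le_limsup_of_frequently_le (Frequently.of_forall (ha N))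
  unfold IterLimZero
  constructor
  · intro h
    refine tendsto_order.2 ⟨fun b hb => Eventually.of_forall fun p => hb.trans_le (ha _ _),
      fun b hb => ?_⟩
    rw [eventually_curry_iff]
    filter_upwards [h.eventually_lt_const hb] with N hN
    exact eventually_lt_of_limsup_lt hN
  · intro h
    refine tendsto_order.2 ⟨fun b hb => Eventually.of_forall fun N => hb.trans_le (h0 N),
      fun b hb => ?_⟩
    -- Terms below c only force the limsup to be at most c, hence the room between c and b.
    obtain ⟨c, hc0, hcb⟩ := exists_between hb
    have := h.eventually_lt_const hc0
    rw [eventually_curry_iff] at this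
    filter_upwards [this] with N hN
    exact (limsup_le_of_le (h := hN.mono fun M h => h.le)).trans_lt hcb

theorem iterLimZero_coe_iff {a : ℕ+ → ℕ+ → ℝ} (ha : ∀ N M, 0 ≤ a N M) :
    IterLimZero (fun N M => (a N M : EReal)) ↔
      Tendsto (fun p : ℕ+ × ℕ+ => a p.1 p.2) iterFilter (𝓝 0) := by
  rw [iterLimZero_iff fun N M => by exact_mod_cast ha N M, ← EReal.coe_zero, EReal.tendsto_coe]

theorem iterLimZero_coe_ennreal_iff {a : ℕ+ → ℕ+ → ENNReal} :
    IterLimZero (fun N M => (a N M : EReal)) ↔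
      Tendsto (fun p : ℕ+ × ℕ+ => a p.1 p.2) iterFilter (𝓝 0) := by
  rw [iterLimZero_iff fun N M => EReal.coe_ennreal_nonneg _, ← EReal.coe_ennreal_zero,
    EReal.tendsto_coe_ennreal]

/-- Dominated convergence for iterated limits. -/
theorem tendsto_lintegral_iterFilter {α : Type*} [MeasurableSpace α] {μ : Measure α}
    [IsFiniteMeasure μ] {F : ℕ+ × ℕ+ → α → ENNReal} {C : ENNReal} (hC : C ≠ ⊤)
    (hm : ∀ p, AEMeasurable (F p) μ) (hb : ∀ p, ∀ᵐ a ∂μ, F p a ≤ C)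
    (hF : ∀ᵐ a ∂μ, Tendsto (fun p => F p a) iterFilter (𝓝 0)) :
    Tendsto (fun p => ∫⁻ a, F p a ∂μ) iterFilter (𝓝 0) := by
  -- `s` is the tail supremum in M and `i` its infimum, the limsup. Ordinary dominated convergence
  -- applies to `s N` as M grows, then to `i` as N grows, and `s` dominates `F`.
  let s : ℕ+ → ℕ+ → α → ENNReal := fun N M a => ⨆ k : {k // M ≤ k}, F (N, k) a
  let i : ℕ+ → α → ENNReal := fun N a => ⨅ M, s N M a
  have hsm : ∀ N M, AEMeasurable (s N M) μ := fun N M => AEMeasurable.iSup fun k => hm _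
  have him : ∀ N, AEMeasurable (i N) μ := fun N => AEMeasurable.iInf fun k => hsm _ _
  have hb' : ∀ᵐ a ∂μ, ∀ p, F p a ≤ C := ae_all_iff.2 hb
  have hCi : ∫⁻ _, C ∂μ ≠ ⊤ := by
    rw [lintegral_const]; exact ENNReal.mul_ne_top hC (measure_ne_top _ _)
  have hs : ∀ N, Tendsto (fun M => ∫⁻ a, s N M a ∂μ) atTop (𝓝 (∫⁻ a, i N a ∂μ)) := by
    intro N
    refine tendsto_lintegral_filter_of_dominated_convergence' (fun _ => C)
      (Eventually.of_forall (hsm N)) (Eventually.of_forall fun M => ?_) hCi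
      (ae_of_all _ fun a => ?_)
    · filter_upwards [hb'] with a ha using iSup_le fun k => ha _
    · refine tendsto_atTop_iInf fun M M' h => ?_
      exact iSup_le fun k => le_iSup (fun k : {k // M ≤ k} => F (N, k) a) ⟨k, h.trans k.2⟩
  have hi : Tendsto (fun N => ∫⁻ a, i N a ∂μ) atTop (𝓝 0) := by
    rw [← lintegral_zero (μ := μ)]
    refine tendsto_lintegral_filter_of_dominated_convergence' (fun _ => C)
      (Eventually.of_forall him) (Eventually.of_forall fun M => ?_) hCi ?_
    · filter_upwards [hb'] with a ha using (iInf_le _ 1).trans (iSup_le fun k => ha _)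
    · filter_upwards [hF] with a ha
      refine ENNReal.tendsto_nhds_zero.2 fun ε hε => ?_
      have := ENNReal.tendsto_nhds_zero.1 ha ε hε
      rw [eventually_curry_iff] at this
      filter_upwards [this] with N hN
      obtain ⟨M, hM⟩ := eventually_atTop.1 hN
      exact (iInf_le _ M).trans (iSup_le fun k => hM _ k.2)
  refine ENNReal.tendsto_nhds_zero.2 fun ε hε => ?_
  rw [eventually_curry_iff]
  filter_upwards [hi.eventually_lt_const hε] with N hN
  filter_upwards [(hs N).eventually_lt_const hN] with M hM
  refine le_trans (lintegral_mono fun a => ?_) hM.le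
  exact le_iSup (fun k : {k // M ≤ k} => F (N, k) a) ⟨M, le_rfl⟩

theorem tendsto_integral_iterFilter {α : Type*} [MeasurableSpace α] {μ : Measure α}
    [IsFiniteMeasure μ] {F : ℕ+ × ℕ+ → α → ℝ} {f : α → ℝ} {C : ℝ}
    (hm : ∀ p, AEMeasurable (F p) μ) (hfm : AEMeasurable f μ)
    (hb : ∀ p, ∀ᵐ a ∂μ, ‖F p a‖ ≤ C) (hfb : ∀ᵐ a ∂μ, ‖f a‖ ≤ C)
    (hF : ∀ᵐ a ∂μ, Tendsto (fun p => F p a) iterFilter (𝓝 (f a))) :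
    Tendsto (fun p => ∫ a, F p a ∂μ) iterFilter (𝓝 (∫ a, f a ∂μ)) := by
  have hFi : ∀ p, Integrable (F p) μ := fun p =>
    Integrable.of_bound (hm p).aestronglyMeasurable C (hb p)
  have hfi : Integrable f μ := Integrable.of_bound hfm.aestronglyMeasurable C hfb
  refine tendsto_integral_of_L1 f hfi.aestronglyMeasurable (Eventually.of_forall hFi) ?_
  refine tendsto_lintegral_iterFilter (C := ENNReal.ofReal (C + C)) ENNReal.ofReal_ne_top
    (fun p => ((hm p).sub hfm).enorm) (fun p => ?_) ?_
  · filter_upwards [hb p, hfb] with a h1 h2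
    rw [← ofReal_norm]
    exact ENNReal.ofReal_le_ofReal ((norm_sub_le _ _).trans (add_le_add h1 h2))
  · filter_upwards [hF] with a ha
    have := (tendsto_iff_norm_sub_tendsto_zero.1 ha)
    simpa [← ofReal_norm] using ENNReal.tendsto_ofReal this

end SPAveraging

/-! ### Absolutely continuous solutions and Gronwall's inequality. -/

namespace SPAveraging

/-- The set `s` is there because a C¹ function is in general Lipschitz only on bounded sets. -/
theorem _root_.LipschitzOnWith.comp_absolutelyContinuousOnInterval {X X' : Type*}
    [PseudoMetricSpace X] [PseudoMetricSpace X'] {K : NNReal} {φ : X → X'} {s : Set X} {x : ℝ → X}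
    {a b : ℝ} (hφ : LipschitzOnWith K φ s) (hx : AbsolutelyContinuousOnInterval x a b)
    (hs : MapsTo x (uIcc a b) s) : AbsolutelyContinuousOnInterval (φ ∘ x) a b := by
  rw [absolutelyContinuousOnInterval_iff] at hx ⊢
  intro ε hε
  -- The `+ 1` keeps the quotient meaningful for `K = 0`.
  obtain ⟨δ, hδ, h⟩ := hx (ε / (K + 1)) (by positivity)
  refine ⟨δ, hδ, fun E hE hlt => ?_⟩
  have h1 := h E hE hlt
  rw [lt_div_iff₀ (by positivity), Finset.sum_mul] at h1
  refine lt_of_le_of_lt (Finset.sum_le_sum fun i hi => ?_) h1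
  have hi' := hE.1 i hi
  refine (hφ.dist_le_mul _ (hs hi'.1) _ (hs hi'.2)).trans ?_
  rw [mul_comm]
  gcongr
  simp

theorem ae_timeMeasure_iff {p : ℝ → Prop} :
    (∀ᵐ t ∂timeMeasure, p t) ↔ ∀ᵐ t, 0 ≤ t → p t :=
  ae_restrict_iff' measurableSet_Ici

theorem ae_uIoc_of_ae_timeMeasure {p : ℝ → Prop} (h : ∀ᵐ t ∂timeMeasure, p t) {T : ℝ}
    (hT : 0 ≤ T) : ∀ᵐ t, t ∈ uIoc 0 T → p t := by
  filter_upwards [ae_timeMeasure_iff.1 h] with t ht h'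
  rw [uIoc_of_le hT] at h'
  exact ht h'.1.le

section Solutions

variable {E : Type*} [NormedAddCommGroup E] [NormedSpace ℝ E] {x v x' v' : ℝ → E}

theorem IsSolution.continuousOn (hx : IsSolution x v) : ContinuousOn x (Ici 0) := by
  intro t ht
  have ht : (0 : ℝ) ≤ t := ht
  have h := (hx.absCont (t + 1) (by linarith)).continuousOn
  rw [uIcc_of_le (by linarith)] at h
  refine (h t ⟨ht, by linarith⟩).mono_of_mem_nhdsWithin ?_
  rw [mem_nhdsWithin]
  exact ⟨Iio (t + 1), isOpen_Iio, by simp, fun s hs => ⟨hs.2, le_of_lt hs.1⟩⟩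

theorem IsSolution.sub (hx : IsSolution x v) (hx' : IsSolution x' v') :
    IsSolution (x - x') (v - v') :=
  ⟨fun T hT => (hx.absCont T hT).sub (hx'.absCont T hT), by
    filter_upwards [hx.ode, hx'.ode] with t h h' using h.sub h'⟩

/-- The fundamental theorem of calculus for a `C¹` function along a solution. -/
theorem IsSolution.integral_fderiv [FiniteDimensional ℝ E] (hx : IsSolution x v) {φ : E → ℝ}
    (hφ : ContDiff ℝ 1 φ) {T : ℝ} (hT : 0 < T) :
    IntervalIntegrable (fun t => fderiv ℝ φ (x t) (v t)) volume 0 T ∧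
      ∫ t in (0 : ℝ)..T, fderiv ℝ φ (x t) (v t) = φ (x T) - φ (x 0) := by
  have hac := hx.absCont T hT
  obtain ⟨R, hR⟩ := hac.exists_bound
  have hbx : MapsTo x (uIcc 0 T) (Metric.closedBall 0 R) := fun t ht => by simpa using hR t ht
  obtain ⟨K, hK⟩ := (hφ.contDiffOn (s := Metric.closedBall (0 : E) R)).exists_lipschitzOnWith
    one_ne_zero (convex_closedBall _ _) (isCompact_closedBall _ _)
  have hc := hK.comp_absolutelyContinuousOnInterval hac hbx
  have hd : ∀ᵐ t, t ∈ uIoc 0 T → deriv (φ ∘ x) t = fderiv ℝ φ (x t) (v t) := by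
    filter_upwards [ae_uIoc_of_ae_timeMeasure hx.ode hT.le] with t ht h
    exact (((hφ.differentiable one_ne_zero) (x t)).hasFDerivAt.comp_hasDerivAt t (ht h)).deriv
  constructor
  · exact hc.intervalIntegrable_deriv.congr_ae
      ((ae_restrict_iff' measurableSet_uIoc).2 hd)
  · rw [← intervalIntegral.integral_congr_ae hd]
    exact hc.integral_deriv_eq_sub

/-- Pairing the difference with its own terminal value reduces the estimate to the scalar
fundamental theorem of calculus; Cauchy–Schwarz and division by the terminal norm finish it. -/
theorem IsSolution.norm_sub_le {E : Type*} [NormedAddCommGroup E] [InnerProductSpace ℝ E]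
    [FiniteDimensional ℝ E] {x v x' v' : ℝ → E} (hx : IsSolution x v) (hx' : IsSolution x' v')
    (h0 : x 0 = x' 0) {b : ℝ → ℝ} {T : ℝ} (hT : 0 ≤ T) (hb : IntervalIntegrable b volume 0 T)
    (hv : ∀ᵐ t, t ∈ uIoc 0 T → ‖v t - v' t‖ ≤ b t) :
    ‖x T - x' T‖ ≤ ∫ t in (0 : ℝ)..T, b t := by
  rcases hT.eq_or_lt with rfl | hT
  · simp [h0]
  rw [uIoc_of_le hT.le] at hv
  have hb0 : 0 ≤ ∫ t in (0 : ℝ)..T, b t := by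
    rw [intervalIntegral.integral_of_le hT.le]
    refine integral_nonneg_of_ae ?_
    exact (ae_restrict_iff' measurableSet_Ioc).2
      (hv.mono fun t ht h => (norm_nonneg _).trans (ht h))
  rcases (norm_nonneg (x T - x' T)).eq_or_lt with hz | hpos
  · rwa [← hz]
  have key := (hx.sub hx').integral_fderiv (φ := innerSL ℝ (x T - x' T))
    (innerSL ℝ (x T - x' T)).contDiff hT
  simp only [ContinuousLinearMap.fderiv, Pi.sub_apply, innerSL_apply_apply, h0, sub_self,
    inner_zero_right, sub_zero] at key
  obtain ⟨hi, he⟩ := key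
  rw [real_inner_self_eq_norm_mul_norm] at he
  have : ∫ t in (0 : ℝ)..T, inner ℝ (x T - x' T) (v t - v' t)
      ≤ ∫ t in (0 : ℝ)..T, ‖x T - x' T‖ * b t := by
    refine intervalIntegral.integral_mono_ae_restrict hT.le hi (hb.const_mul _) ?_
    rw [← restrict_Ioc_eq_restrict_Icc]
    refine (ae_restrict_iff' measurableSet_Ioc).2 ?_
    filter_upwards [hv] with t ht h
    exact (real_inner_le_norm _ _).trans (by gcongr; exact ht h)
  rw [he, intervalIntegral.integral_const_mul] at this
  exact le_of_mul_le_mul_left this hpos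

end Solutions

/-- Gronwall's inequality in integral form. -/
theorem le_mul_exp_of_le_integral {e : ℝ → ℝ} {a K T : ℝ} (he : ContinuousOn e (Icc 0 T))
    (hT : 0 ≤ T) (hK : 0 ≤ K) (h : ∀ t ∈ Icc 0 T, e t ≤ a + K * ∫ s in (0 : ℝ)..t, e s) :
    e T ≤ a * Real.exp (K * T) := by
  have hint : ∀ t ∈ Icc 0 T, IntervalIntegrable e volume 0 t := fun t ht =>
    (he.mono (by rw [uIcc_of_le ht.1]; exact Icc_subset_Icc_right ht.2)).intervalIntegrable
  -- The differential form is applied to the majorant on the right-hand side, which has right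
  -- derivative `K * e t`; `e` itself is only continuous.
  have key := le_gronwallBound_of_liminf_deriv_right_le (K := K) (ε := 0) (δ := a)
    (f := fun t => a + K * ∫ s in (0 : ℝ)..t, e s) (f' := fun t => K * e t) (a := 0) (b := T)
    ?_ ?_ (by simp) ?_ T ⟨hT, le_rfl⟩
  · rw [gronwallBound_ε0, sub_zero] at key
    exact (h T ⟨hT, le_rfl⟩).trans key
  · refine continuousOn_const.add (continuousOn_const.mul ?_)
    have := intervalIntegral.continuousOn_primitive_interval' (a := 0) (hint T ⟨hT, le_rfl⟩)
      (by simp)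
    rwa [uIcc_of_le hT] at this
  · intro t ht r hr
    have h1 : HasDerivWithinAt (fun u => ∫ s in (0 : ℝ)..u, e s) (e t) (Ici t) t := by
      have hct : ContinuousWithinAt e (Ioi t) t :=
        ((he t ⟨ht.1, ht.2.le⟩).mono_of_mem_nhdsWithin (by
          rw [mem_nhdsWithin]
          exact ⟨Iio T, isOpen_Iio, ht.2, fun s hs => ⟨ht.1.trans (le_of_lt hs.2), le_of_lt hs.1⟩⟩))
      refine intervalIntegral.integral_hasDerivWithinAt_right (hint t ⟨ht.1, ht.2.le⟩) ?_ hct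
      refine ⟨Icc 0 T, ?_, he.aestronglyMeasurable measurableSet_Icc⟩
      rw [mem_nhdsWithin]
      exact ⟨Iio T, isOpen_Iio, ht.2, fun s hs => ⟨ht.1.trans (le_of_lt hs.2), le_of_lt hs.1⟩⟩
    have h2 := (h1.const_mul K).const_add a
    simpa only [slope_def_field, div_eq_inv_mul] using h2.liminf_right_slope_le hr
  · intro t ht
    have := h t ⟨ht.1, ht.2.le⟩
    rw [add_zero]
    exact mul_le_mul_of_nonneg_left this hK

end SPAveraging

/-! ### Stability of solutions under perturbations small off small sets of times. -/

namespace SPAveraging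

theorem timeMeasure_restrict_le {T : ℝ} : volume.restrict (Ioc 0 T) ≤ timeMeasure :=
  Measure.restrict_mono (fun _ hs => hs.1.le) le_rfl

/-- Continuous dependence of solutions for iterated limits: the right-hand sides `v p` are close
to `v'` up to a Lipschitz term, except for small sets of times. -/
theorem tendsto_norm_sub_of_perturbation {E : Type*} [NormedAddCommGroup E]
    [InnerProductSpace ℝ E] [FiniteDimensional ℝ E] {x v : ℕ+ × ℕ+ → ℝ → E} {x' v' : ℝ → E}
    (hx : ∀ p, IsSolution (x p) (v p)) (hx' : IsSolution x' v') (h0 : ∀ p, x p 0 = x' 0)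
    {K C : ℝ} (hK : 0 ≤ K) {δ : ℕ+ × ℕ+ → ℝ → ℝ} (hδm : ∀ p, AEMeasurable (δ p) timeMeasure)
    (hδ0 : ∀ p s, 0 ≤ δ p s) (hδC : ∀ p s, δ p s ≤ C)
    (hδ : ∀ᵐ s ∂timeMeasure, Tendsto (fun p => δ p s) iterFilter (𝓝 0))
    {bad : ℕ+ × ℕ+ → Set ℝ}
    (hbad : ∀ T > 0, Tendsto (fun p => volume {s | s ∈ Icc 0 T ∧ s ∈ bad p}) iterFilter (𝓝 0))
    (hC : ∀ p, ∀ᵐ s ∂timeMeasure, ‖v p s - v' s‖ ≤ C)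
    (hlip : ∀ p, ∀ᵐ s ∂timeMeasure, s ∉ bad p → ‖v p s - v' s‖ ≤ K * ‖x p s - x' s‖ + δ p s)
    {T : ℝ} (hT : 0 ≤ T) : Tendsto (fun p => ‖x p T - x' T‖) iterFilter (𝓝 0) := by
  rcases hT.eq_or_lt with rfl | hT
  · simp only [h0, sub_self, norm_zero]
    exact tendsto_const_nhds
  have hC0 : 0 ≤ C := (hδ0 1 0).trans (hδC 1 0)
  -- The bad sets need not be measurable; a measurable hull has the same measure.
  set B : ℕ+ × ℕ+ → Set ℝ := fun p => toMeasurable volume {s | s ∈ Icc 0 T ∧ s ∈ bad p} with hB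
  have hBm : ∀ p, MeasurableSet (B p) := fun p => measurableSet_toMeasurable _ _
  have hBfin : ∀ p, volume (B p) ≠ ⊤ := fun p => by
    rw [hB, measure_toMeasurable]
    exact ((measure_mono fun s hs => hs.1).trans_lt (measure_Icc_lt_top (a := 0) (b := T))).ne
  have hδi : ∀ p, IntervalIntegrable (δ p) volume 0 T := fun p => by
    rw [intervalIntegrable_iff_integrableOn_Ioc_of_le hT.le]
    refine Integrable.of_bound ((hδm p).mono_measure timeMeasure_restrict_le).aestronglyMeasurable
      C (ae_of_all _ fun s => ?_)
    rw [Real.norm_of_nonneg (hδ0 p s)]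
    exact hδC p s
  have hBi : ∀ p, IntervalIntegrable ((B p).indicator fun _ => C) volume 0 T := fun p =>
    (intervalIntegrable_iff_integrableOn_Ioc_of_le hT.le).2
      ((integrable_const C).indicator (hBm p))
  -- The constant term in Gronwall's inequality: the integrated discrepancy `δ`, plus the crude
  -- bound `C` charged on the bad times.
  set a : ℕ+ × ℕ+ → ℝ := fun p => (∫ s in (0 : ℝ)..T, δ p s) + C * volume.real (B p) with ha
  have ha0 : Tendsto a iterFilter (𝓝 0) := by
    have h1 : Tendsto (fun p => ∫ s in (0 : ℝ)..T, δ p s) iterFilter (𝓝 0) := by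
      simp only [intervalIntegral.integral_of_le hT.le]
      have := tendsto_integral_iterFilter (μ := volume.restrict (Ioc 0 T)) (F := δ)
        (f := fun _ => 0) (C := C) (fun p => (hδm p).mono_measure timeMeasure_restrict_le)
        aemeasurable_const (fun p => ae_of_all _ fun s => by
          rw [Real.norm_of_nonneg (hδ0 p s)]; exact hδC p s) (by simp [hC0])
        (ae_mono timeMeasure_restrict_le hδ)
      simpa using this
    have h2 : Tendsto (fun p => volume.real (B p)) iterFilter (𝓝 0) := by
      simp only [hB, Measure.real, measure_toMeasurable]
      exact (ENNReal.tendsto_toReal_zero_iff fun p => by simpa [hB] using hBfin p).2 (hbad T hT)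
    simpa using h1.add (h2.const_mul C)
  have hcont : ∀ p, ContinuousOn (fun s => ‖x p s - x' s‖) (Icc 0 T) := fun p =>
    (((hx p).continuousOn.sub hx'.continuousOn).norm).mono Icc_subset_Ici_self
  have key : ∀ p, ∀ t ∈ Icc 0 T,
      ‖x p t - x' t‖ ≤ a p + K * ∫ s in (0 : ℝ)..t, ‖x p s - x' s‖ := by
    intro p t ht
    have hei : IntervalIntegrable (fun s => ‖x p s - x' s‖) volume 0 t :=
      ((hcont p).mono (by rw [uIcc_of_le ht.1]; exact Icc_subset_Icc_right ht.2)).intervalIntegrable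
    have hsub : uIcc 0 t ⊆ uIcc 0 T := by
      rw [uIcc_of_le ht.1, uIcc_of_le hT.le]; exact Icc_subset_Icc_right ht.2
    have hδt := (hδi p).mono_set hsub
    have hBt := (hBi p).mono_set hsub
    have hle := (hx p).norm_sub_le hx' (h0 p) ht.1
      (b := fun s => K * ‖x p s - x' s‖ + (δ p s + (B p).indicator (fun _ => C) s))
      ((hei.const_mul K).add (hδt.add hBt)) (by
        filter_upwards [ae_uIoc_of_ae_timeMeasure (hC p) ht.1,
          ae_uIoc_of_ae_timeMeasure (hlip p) ht.1] with s h1 h2 hs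
        have hs' := hs
        rw [uIoc_of_le ht.1] at hs'
        have hn : 0 ≤ K * ‖x p s - x' s‖ := by positivity
        by_cases hb : s ∈ bad p
        · have : s ∈ B p := subset_toMeasurable _ _ ⟨⟨hs'.1.le, hs'.2.trans ht.2⟩, hb⟩
          rw [indicator_of_mem this]
          linarith [h1 hs, hδ0 p s]
        · have : 0 ≤ (B p).indicator (fun _ => C) s := indicator_nonneg (fun _ _ => hC0) s
          linarith [h2 hs hb])
    rw [intervalIntegral.integral_add (hei.const_mul K) (hδt.add hBt),
      intervalIntegral.integral_const_mul, intervalIntegral.integral_add hδt hBt] at hle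
    have h1 : ∫ s in (0 : ℝ)..t, δ p s ≤ ∫ s in (0 : ℝ)..T, δ p s :=
      intervalIntegral.integral_mono_interval le_rfl ht.1 ht.2 (ae_of_all _ (hδ0 p)) (hδi p)
    have h2 : ∫ s in (0 : ℝ)..t, (B p).indicator (fun _ => C) s ≤ C * volume.real (B p) := by
      rw [intervalIntegral.integral_of_le ht.1, integral_indicator (hBm p), setIntegral_const,
        smul_eq_mul, mul_comm, Measure.real, Measure.restrict_apply (hBm p)]
      refine mul_le_mul_of_nonneg_left ?_ hC0
      exact ENNReal.toReal_mono (hBfin p) (measure_mono inter_subset_left)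
    linarith
  have hfin := fun p => le_mul_exp_of_le_integral (hcont p) hT.le hK (key p)
  refine squeeze_zero (fun p => norm_nonneg _) hfin ?_
  simpa using ha0.mul_const (Real.exp (K * T))

end SPAveraging

/-! ### Linear programming duality over probability measures. -/

namespace SPAveraging

section Duality

variable {X : Type*} [TopologicalSpace X] [CompactSpace X] [TopologicalSpace.MetrizableSpace X]
  [MeasurableSpace X] [BorelSpace X]

theorem _root_.Continuous.integrable_of_compactSpace {E : Type*} [NormedAddCommGroup E]
    {h : X → E} (hh : Continuous h) (μ : Measure X) [IsFiniteMeasure μ] : Integrable h μ :=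
  hh.integrable_of_hasCompactSupport (HasCompactSupport.of_compactSpace _)

theorem exists_convexCombination (μ ν : ProbabilityMeasure X) {a b : ℝ} (ha : 0 ≤ a) (hb : 0 ≤ b)
    (hab : a + b = 1) : ∃ π : ProbabilityMeasure X, ∀ h : X → ℝ, Continuous h →
      ∫ x, h x ∂(π : Measure X)
        = a * ∫ x, h x ∂(μ : Measure X) + b * ∫ x, h x ∂(ν : Measure X) := by
  lift a to NNReal using ha
  lift b to NNReal using hb
  have hab' : a + b = 1 := by exact_mod_cast hab
  refine ⟨⟨a • (μ : Measure X) + b • (ν : Measure X), ⟨?_⟩⟩, fun h hh => ?_⟩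
  · rw [Measure.add_apply, Measure.smul_apply, Measure.smul_apply, measure_univ, measure_univ,
      ENNReal.smul_def, ENNReal.smul_def, smul_eq_mul, smul_eq_mul, mul_one, mul_one,
      ← ENNReal.coe_add, hab', ENNReal.coe_one]
  · rw [ProbabilityMeasure.coe_mk, integral_add_measure ((hh.integrable_of_compactSpace _))
      ((hh.integrable_of_compactSpace _)), integral_smul_nnreal_measure,
      integral_smul_nnreal_measure]
    simp [NNReal.smul_def]

/-- Duality for a linear program over probability measures with finitely many constraints. -/
theorem exists_multiplier {M : ℕ} {h : X → ℝ} (hh : Continuous h) {k : ℕ → X → ℝ}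
    (hk : ∀ i, Continuous (k i)) {v : ℝ}
    (hv : ∀ μ : ProbabilityMeasure X, (∀ i < M, ∫ x, k i x ∂(μ : Measure X) = 0) →
      v ≤ ∫ x, h x ∂(μ : Measure X))
    (hne : ∃ μ : ProbabilityMeasure X, ∀ i < M, ∫ x, k i x ∂(μ : Measure X) = 0) {w : ℝ}
    (hw : w < v) : ∃ c : ℕ → ℝ, ∀ x, w ≤ h x + ∑ i ∈ Finset.range M, c i * k i x := by
  let Φ : ProbabilityMeasure X → ℝ × (Fin M → ℝ) := fun μ =>
    (∫ x, h x ∂(μ : Measure X), fun i => ∫ x, k i x ∂(μ : Measure X))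
  have hΦ : Continuous Φ :=
    (continuous_integral_probabilityMeasure hh).prodMk (continuous_pi fun i =>
      continuous_integral_probabilityMeasure (hk i))
  have hconv : Convex ℝ (range Φ) := by
    rintro _ ⟨μ, rfl⟩ _ ⟨ν, rfl⟩ a b ha hb hab
    obtain ⟨π, hπ⟩ := exists_convexCombination μ ν ha hb hab
    exact ⟨π, Prod.ext (hπ h hh) (funext fun i => hπ _ (hk i))⟩
  -- The compact convex set of attainable values misses the ray `Iic w × {0}`, since a feasible
  -- measure costs at least `v > w`. A functional separates the two strictly.
  obtain ⟨f, u, u', hu, huu, hu'⟩ := geometric_hahn_banach_compact_closed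
    (t := Iic w ×ˢ ({0} : Set (Fin M → ℝ))) hconv (isCompact_range hΦ)
    ((convex_Iic w).prod (convex_singleton 0)) (isClosed_Iic.prod isClosed_singleton) (by
      rw [Set.disjoint_left]
      rintro _ ⟨μ, rfl⟩ ⟨h1, h2⟩
      refine absurd (hv μ fun i hi => congrFun h2 ⟨i, hi⟩) (not_le.2 (lt_of_le_of_lt h1 hw)))
  set α : ℝ := f (1, 0) with hα
  have hf : ∀ a b, f (a, b) = α * a + ∑ i, b i * f (0, Pi.single i 1) := by
    intro a b
    have h1 : (a, b) = a • ((1 : ℝ), (0 : Fin M → ℝ))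
        + ∑ i, b i • ((0 : ℝ), (Pi.single i 1 : Fin M → ℝ)) := by
      refine Prod.ext (by simp [Prod.fst_sum]) (funext fun j => ?_)
      simp [Prod.snd_sum, Finset.sum_apply, Pi.single_apply]
    rw [h1, map_add, map_smul, map_sum]
    simp only [map_smul, smul_eq_mul]
    rw [mul_comm]
  obtain ⟨μ, hμ⟩ := hne
  -- The separation at a feasible measure reads `α * cost < α * w` with cost above `w`, which
  -- excludes `0 ≤ α`.
  have hα0 : α < 0 := by
    have h1 := hu _ ⟨μ, rfl⟩
    have h2 := hu' (w, 0) ⟨self_mem_Iic, rfl⟩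
    have h3 : Φ μ = (∫ x, h x ∂(μ : Measure X), 0) := Prod.ext rfl (funext fun i => hμ i i.2)
    rw [h3] at h1
    rw [hf] at h1 h2
    simp only [Pi.zero_apply, zero_mul, Finset.sum_const_zero, add_zero] at h1 h2
    have h4 := hv μ hμ
    by_contra hcon
    have := mul_le_mul_of_nonneg_left (hw.le.trans h4) (not_lt.1 hcon)
    linarith
  refine ⟨fun i => if hi : i < M then f (0, Pi.single ⟨i, hi⟩ 1) / α else 0, fun x => ?_⟩
  -- Dirac measures make the separation pointwise; dividing by the negative `α` yields the
  -- multipliers.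
  have h1 := hu _ ⟨⟨Measure.dirac x, inferInstance⟩, rfl⟩
  have h2 := hu' (w, 0) ⟨self_mem_Iic, rfl⟩
  rw [hf] at h1 h2
  simp only [Pi.zero_apply, zero_mul, Finset.sum_const_zero, add_zero, ProbabilityMeasure.coe_mk,
    integral_dirac] at h1 h2
  rw [Finset.sum_range]
  simp only [Fin.is_lt, dite_true, Fin.eta]
  have h3 : α * (h x + ∑ i : Fin M, f (0, Pi.single i 1) / α * k i x)
      = α * h x + ∑ i : Fin M, k i x * f (0, Pi.single i 1) := by
    rw [mul_add, Finset.mul_sum]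
    congr 1
    refine Finset.sum_congr rfl fun i _ => ?_
    have := hα0.ne
    field_simp
  refine (mul_le_mul_left_of_neg hα0).1 ?_
  rw [h3]
  linarith

end Duality

end SPAveraging

/-! ### Constraints given by test functions. -/

namespace SPAveraging

section General

variable {X : Type*} [TopologicalSpace X] [MeasurableSpace X]

theorem apply_eq_one_iff_ae {A : Set X} (hA : MeasurableSet A) (p : ProbabilityMeasure X) :
    p A = 1 ↔ ∀ᵐ x ∂(p : Measure X), x ∈ A := by
  rw [← ENNReal.coe_eq_one, ProbabilityMeasure.ennreal_coeFn_eq_coeFn_toMeasure,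
    ← prob_compl_eq_zero_iff hA]
  exact mem_ae_iff.symm

theorem isClosed_setOf_apply_eq_one [OpensMeasurableSpace X] [HasOuterApproxClosed X] {A : Set X}
    (hA : IsClosed A) : IsClosed {p : ProbabilityMeasure X | p A = 1} := by
  have : {p : ProbabilityMeasure X | p A = 1}
      = {p : ProbabilityMeasure X | 0 < (p : Measure X) Aᶜ}ᶜ := by
    ext p
    rw [mem_ofPred_eq, apply_eq_one_iff_ae hA.measurableSet, mem_compl_iff, mem_ofPred_eq, not_lt,
      nonpos_iff_eq_zero]
    exact mem_ae_iff
  rw [this, isClosed_compl_iff]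
  exact isOpen_setOf_measure_pos hA.isOpen_compl

end General

section Approximation

variable {d : ℕ} {χ : ℕ → EuclideanSpace ℝ (Fin d) → ℝ} {K : Set (EuclideanSpace ℝ (Fin d))}

theorem fderiv_linearCombination (hχ : ∀ i, ContDiff ℝ 1 (χ i)) (k : ℕ) (c : ℕ → ℝ)
    (x : EuclideanSpace ℝ (Fin d)) :
    fderiv ℝ (fun x => ∑ i ∈ Finset.range k, c i * χ i x) x
      = ∑ i ∈ Finset.range k, c i • fderiv ℝ (χ i) x := by
  have hd : ∀ i, DifferentiableAt ℝ (χ i) x := fun i => (hχ i).differentiable one_ne_zero x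
  rw [fderiv_fun_sum fun i _ => (hd i).const_mul (c i)]
  exact Finset.sum_congr rfl fun i _ => fderiv_const_mul (hd i) (c i)

theorem InSpan.contDiff (hχ : ∀ i, ContDiff ℝ 1 (χ i)) {k : ℕ} {h : EuclideanSpace ℝ (Fin d) → ℝ}
    (hh : InSpan χ k h) : ContDiff ℝ 1 h := by
  obtain ⟨c, rfl⟩ := hh
  exact ContDiff.sum fun i _ => contDiff_const.mul (hχ i)

variable {X : Type*} [TopologicalSpace X] [CompactSpace X] [TopologicalSpace.MetrizableSpace X]
  [MeasurableSpace X] [BorelSpace X] {r w : X → EuclideanSpace ℝ (Fin d)}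

theorem continuous_fderiv_apply {h : EuclideanSpace ℝ (Fin d) → ℝ} (hh : ContDiff ℝ 1 h)
    {X : Type*} [TopologicalSpace X] {r w : X → EuclideanSpace ℝ (Fin d)}
    (hr : Continuous r) (hw : Continuous w) : Continuous fun x => fderiv ℝ h (r x) (w x) :=
  ((hh.continuous_fderiv one_ne_zero).comp hr).clm_apply hw

theorem integral_fderiv_linearCombination (hχ : ∀ i, ContDiff ℝ 1 (χ i)) (hr : Continuous r)
    (hw : Continuous w) (μ : ProbabilityMeasure X) (k : ℕ) (c : ℕ → ℝ)
    (h0 : ∀ i < k, ∫ x, fderiv ℝ (χ i) (r x) (w x) ∂(μ : Measure X) = 0) :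
    ∫ x, fderiv ℝ (fun x => ∑ i ∈ Finset.range k, c i * χ i x) (r x) (w x)
      ∂(μ : Measure X) = 0 := by
  simp only [fderiv_linearCombination hχ, _root_.sum_apply,
    _root_.smul_apply, smul_eq_mul]
  rw [integral_finsetSum _ fun i _ =>
    ((continuous_fderiv_apply (hχ i) hr hw).integrable_of_compactSpace _).const_mul _]
  refine Finset.sum_eq_zero fun i hi => ?_
  rw [integral_const_mul, h0 i (Finset.mem_range.1 hi), mul_zero]

/-- Countably many constraints imply all of them: as `w` is bounded, uniform approximation of the
gradient moves the integral by an arbitrarily small amount. -/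
theorem ApproximatesC1.integral_fderiv_eq_zero (hχ : ApproximatesC1 χ K) (hr : Continuous r)
    (hrK : ∀ x, r x ∈ K) (hw : Continuous w) (μ : ProbabilityMeasure X)
    (h0 : ∀ i, ∫ x, fderiv ℝ (χ i) (r x) (w x) ∂(μ : Measure X) = 0)
    {h : EuclideanSpace ℝ (Fin d) → ℝ} (hh : ContDiff ℝ 1 h) :
    ∫ x, fderiv ℝ h (r x) (w x) ∂(μ : Measure X) = 0 := by
  obtain ⟨C, hC⟩ := isCompact_univ.exists_bound_of_continuousOn hw.continuousOn
  have hC' : 0 ≤ max C 0 := le_max_right _ _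
  rw [← norm_le_zero_iff]
  refine le_of_forall_pos_le_add fun ε hε => ?_
  rw [zero_add]
  obtain ⟨k, c, hkc⟩ := hχ.approx h hh (ε / (max C 0 + 1)) (by positivity)
  have h1 := integral_fderiv_linearCombination hχ.contDiff hr hw μ k c fun i _ => h0 i
  have hs : ContDiff ℝ 1 fun x => ∑ i ∈ Finset.range k, c i * χ i x :=
    InSpan.contDiff hχ.contDiff ⟨c, rfl⟩
  rw [← sub_zero (∫ x, fderiv ℝ h (r x) (w x) ∂(μ : Measure X)), ← h1, ← integral_sub
    ((continuous_fderiv_apply hh hr hw).integrable_of_compactSpace _)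
    ((continuous_fderiv_apply hs hr hw).integrable_of_compactSpace _)]
  have := norm_integral_le_of_norm_le_const (μ := (μ : Measure X)) (C := ε)
    (f := fun x => fderiv ℝ h (r x) (w x)
      - fderiv ℝ (fun x => ∑ i ∈ Finset.range k, c i * χ i x) (r x) (w x))
    (ae_of_all _ fun x => by
      rw [fderiv_linearCombination hχ.contDiff, ← _root_.sub_apply]
      refine (ContinuousLinearMap.le_opNorm _ _).trans ?_
      have h2 := (hkc (r x) (hrK x)).2.le
      have h3 : ‖w x‖ ≤ max C 0 + 1 :=
        (hC x (mem_univ _)).trans ((le_max_left _ _).trans (by linarith))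
      calc _ ≤ ε / (max C 0 + 1) * (max C 0 + 1) := by gcongr
        _ = ε := by field_simp)
  rwa [probReal_univ, mul_one] at this

end Approximation

/-! ### Approximating programs, their convergence and complementary slackness. -/

variable {U : Type*} [MetricSpace U] [CompactSpace U] [MeasurableSpace U] [BorelSpace U] {m n : ℕ}

namespace SPSystem

variable (D : SPSystem U m n)

theorem continuous_f' : Continuous fun p : (U × D.Y) × D.Z => D.f p.1.1 p.1.2 p.2 :=
  D.continuous_f.comp (f := fun p : (U × D.Y) × D.Z => (p.1.1, (p.1.2 : EuclideanSpace ℝ (Fin m)),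
    (p.2 : EuclideanSpace ℝ (Fin n)))) (by fun_prop)

theorem continuous_g' : Continuous fun p : (U × D.Y) × D.Z => D.g p.1.1 p.1.2 p.2 :=
  D.continuous_g.comp (f := fun p : (U × D.Y) × D.Z => (p.1.1, (p.1.2 : EuclideanSpace ℝ (Fin m)),
    (p.2 : EuclideanSpace ℝ (Fin n)))) (by fun_prop)

theorem continuous_G' : Continuous fun p : (U × D.Y) × D.Z => D.G p.1.1 p.1.2 p.2 :=
  D.continuous_G.comp (f := fun p : (U × D.Y) × D.Z => (p.1.1, (p.1.2 : EuclideanSpace ℝ (Fin m)),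
    (p.2 : EuclideanSpace ℝ (Fin n)))) (by fun_prop)

theorem continuous_f_right (z : D.Z) : Continuous fun x : U × D.Y => D.f x.1 x.2 z :=
  D.continuous_f'.comp (Continuous.prodMk_left z)

theorem continuous_g_right (z : D.Z) : Continuous fun x : U × D.Y => D.g x.1 x.2 z :=
  D.continuous_g'.comp (Continuous.prodMk_left z)

theorem continuous_G_right (z : D.Z) : Continuous fun x : U × D.Y => D.G x.1 x.2 z :=
  D.continuous_G'.comp (Continuous.prodMk_left z)

theorem continuous_GTilde : Continuous fun q : D.FastMeas × D.Z => D.GTilde q.1 q.2 :=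
  continuous_integral_prod (H := fun (x : U × D.Y) (z : D.Z) => D.G x.1 x.2 z) D.continuous_G'

theorem clm_gTilde {F : Type*} [NormedAddCommGroup F] [NormedSpace ℝ F] [CompleteSpace F]
    (ℓ : EuclideanSpace ℝ (Fin n) →L[ℝ] F) (μ : D.FastMeas) (z : D.Z) :
    ℓ (D.gTilde μ z) = ∫ x, ℓ (D.g x.1 x.2 z) ∂(μ : Measure (U × D.Y)) :=
  (ℓ.integral_comp_comm ((D.continuous_g_right z).integrable_of_compactSpace _)).symm

theorem continuous_gTilde : Continuous fun q : D.FastMeas × D.Z => D.gTilde q.1 q.2 := by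
  rw [← (EuclideanSpace.equiv (Fin n) ℝ).comp_continuous_iff]
  refine continuous_pi fun i => ?_
  have h : ∀ q : D.FastMeas × D.Z, (EuclideanSpace.equiv (Fin n) ℝ) (D.gTilde q.1 q.2) i
      = ∫ x, (D.g x.1 x.2 q.2) i ∂(q.1 : Measure (U × D.Y)) := fun q =>
    D.clm_gTilde (EuclideanSpace.proj i) q.1 q.2
  simp only [Function.comp_def, h]
  exact continuous_integral_prod (H := fun (x : U × D.Y) (z : D.Z) => (D.g x.1 x.2 z) i)
    (((EuclideanSpace.proj (𝕜 := ℝ) i).continuous).comp D.continuous_g')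

theorem continuous_integral_fderiv_f {h : EuclideanSpace ℝ (Fin m) → ℝ} (hh : ContDiff ℝ 1 h) :
    Continuous fun q : D.FastMeas × D.Z =>
      ∫ x, fderiv ℝ h x.2 (D.f x.1 x.2 q.2) ∂(q.1 : Measure (U × D.Y)) :=
  continuous_integral_prod (H := fun (x : U × D.Y) (z : D.Z) => fderiv ℝ h x.2 (D.f x.1 x.2 z))
    (continuous_fderiv_apply hh (r := fun p : (U × D.Y) × D.Z => (p.1.2 : EuclideanSpace ℝ (Fin m)))
      (by fun_prop) D.continuous_f')

theorem continuous_fderiv_gTilde {h : EuclideanSpace ℝ (Fin n) → ℝ} (hh : ContDiff ℝ 1 h) :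
    Continuous fun q : D.FastMeas × D.Z => fderiv ℝ h q.2 (D.gTilde q.1 q.2) :=
  continuous_fderiv_apply hh (by fun_prop) D.continuous_gTilde

theorem continuous_cost : Continuous D.cost :=
  continuous_integral_probabilityMeasure D.continuous_GTilde

theorem bddBelow_cost_image (A : Set D.SlowMeas) : BddBelow (D.cost '' A) :=
  (isCompact_range D.continuous_cost).bddBelow.mono (image_subset_range _ _)

section TestFunctions

variable {ψ : ℕ → EuclideanSpace ℝ (Fin n) → ℝ} {φ : ℕ → EuclideanSpace ℝ (Fin m) → ℝ}

theorem isClosed_graphWM (hφ : ∀ i, ContDiff ℝ 1 (φ i)) (M : ℕ) : IsClosed (D.graphWM φ M) := by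
  have : D.graphWM φ M = ⋂ i, ⋂ (_ : i < M), {q : D.FastMeas × D.Z |
      ∫ x, fderiv ℝ (φ i) x.2 (D.f x.1 x.2 q.2) ∂(q.1 : Measure (U × D.Y)) = 0} := by
    ext q; simp [graphWM, WM]
  rw [this]
  exact isClosed_iInter fun i => isClosed_iInter fun _ =>
    isClosed_eq (D.continuous_integral_fderiv_f (hφ i)) continuous_const

theorem graphW_eq_iInter (hφ : ApproximatesC1 φ D.Y) : D.graphW = ⋂ M, D.graphWM φ M := by
  ext q
  simp only [graphW, graphWM, W, WM, mem_ofPred_eq, mem_iInter]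
  refine ⟨fun h M i _ => h _ (hφ.contDiff i), fun h ψ hψ => ?_⟩
  exact hφ.integral_fderiv_eq_zero (r := fun x : U × D.Y => (x.2 : EuclideanSpace ℝ (Fin m)))
    (by fun_prop) (fun x => x.2.2) (D.continuous_f_right q.2) q.1
    -- Level `M` uses the indices `i < M`, so the constraint with index `i` first appears at level
    -- `i + 1`.
    (fun i => h (i + 1) i (Nat.lt_succ_self i)) hψ

theorem isClosed_tildeWNM (hψ : ∀ i, ContDiff ℝ 1 (ψ i)) (hφ : ∀ i, ContDiff ℝ 1 (φ i)) (N M : ℕ) :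
    IsClosed (D.tildeWNM ψ φ N M) := by
  have : D.tildeWNM ψ φ N M = {p : D.SlowMeas | p (D.graphWM φ M) = 1} ∩ ⋂ i, ⋂ (_ : i < N),
      {p : D.SlowMeas | ∫ q, fderiv ℝ (ψ i) q.2 (D.gTilde q.1 q.2)
        ∂(p : Measure (D.FastMeas × D.Z)) = 0} := by
    ext q; simp [tildeWNM]
  rw [this]
  exact (isClosed_setOf_apply_eq_one (D.isClosed_graphWM hφ M)).inter
    (isClosed_iInter fun i => isClosed_iInter fun _ => isClosed_eq
      (continuous_integral_probabilityMeasure (D.continuous_fderiv_gTilde (hψ i))) continuous_const)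

theorem tildeWNM_anti {N N' M M' : ℕ} (hN : N ≤ N') (hM : M ≤ M') :
    D.tildeWNM ψ φ N' M' ⊆ D.tildeWNM ψ φ N M := by
  rintro p ⟨h1, h2⟩
  refine ⟨le_antisymm (p.apply_le_one _) ?_, fun i hi => h2 i (hi.trans_le hN)⟩
  rw [← h1]
  exact p.apply_mono fun q hq i hi => hq i (hi.trans_le hM)

/-- The diagonal suffices because the sets decrease in both indices. Full mass on `graphW` is full
mass on each of the countably many closed sets it is cut out by. -/
theorem tildeW_eq_iInter (hψ : ApproximatesC1 ψ D.Z) (hφ : ApproximatesC1 φ D.Y) :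
    D.tildeW = ⋂ k, D.tildeWNM ψ φ k k := by
  ext p
  simp only [tildeW, tildeWNM, mem_iInter, mem_ofPred_eq]
  have hm : ∀ M, MeasurableSet (D.graphWM φ M) := fun M =>
    (D.isClosed_graphWM hφ.contDiff M).measurableSet
  simp only [apply_eq_one_iff_ae (hm _), D.graphW_eq_iInter hφ,
    apply_eq_one_iff_ae (MeasurableSet.iInter hm), mem_iInter, ae_all_iff]
  refine ⟨fun h k => ⟨h.1 k, fun i _ => h.2 _ (hψ.contDiff i)⟩, fun h => ⟨fun k => (h k).1, ?_⟩⟩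
  intro χ hχ
  exact hψ.integral_fderiv_eq_zero (r := fun q : D.FastMeas × D.Z =>
    (q.2 : EuclideanSpace ℝ (Fin n))) (by fun_prop) (fun q => q.2.2) D.continuous_gTilde p
    (fun i => (h (i + 1)).2 i (Nat.lt_succ_self i)) hχ

theorem exists_mem_tildeWNM_cost_eq (hψ : ∀ i, ContDiff ℝ 1 (ψ i)) (hφ : ∀ i, ContDiff ℝ 1 (φ i))
    {N M : ℕ} (hne : (D.tildeWNM ψ φ N M).Nonempty) :
    ∃ p ∈ D.tildeWNM ψ φ N M, D.cost p = D.GNM ψ φ N M := by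
  obtain ⟨p, hp, h⟩ := (D.isClosed_tildeWNM hψ hφ N M).isCompact.exists_sInf_image_eq hne
    D.continuous_cost.continuousOn
  exact ⟨p, hp, h.symm⟩

/-- Solutions of the approximating problems converge to the solution of the limit problem, if the
latter is unique. -/
theorem tendsto_of_mem_tildeWNM (hψ : ApproximatesC1 ψ D.Z) (hφ : ApproximatesC1 φ D.Y)
    {pStar : D.SlowMeas} (huniq : ∀ p ∈ D.tildeW, D.cost p = D.GStar → p = pStar)
    {q : ℕ+ × ℕ+ → D.SlowMeas} (hq : ∀ p, q p ∈ D.tildeWNM ψ φ p.1 p.2)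
    (hc : ∀ p, D.cost (q p) ≤ D.GStar) : Tendsto q (atTop ×ˢ atTop) (𝓝 pStar) := by
  intro A hA
  -- Decreasing compact sets. A point common to all of them is feasible with cost at most `GStar`,
  -- hence optimal and equal to `pStar`; so some `V k` lies in the given neighbourhood.
  let V : ℕ → Set D.SlowMeas := fun k => D.tildeWNM ψ φ k k ∩ {p | D.cost p ≤ D.GStar}
  obtain ⟨k, hk⟩ := exists_subset_nhds_of_isCompact (V := V) (U := A)
    (directed_of_isDirected_le fun i j hij =>
      inter_subset_inter_left _ (D.tildeWNM_anti hij hij))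
    (fun k => ((D.isClosed_tildeWNM hψ.contDiff hφ.contDiff k k).inter
      (isClosed_le D.continuous_cost continuous_const)).isCompact) (fun p hp => by
        rw [mem_iInter] at hp
        have h1 : p ∈ D.tildeW := by
          rw [D.tildeW_eq_iInter hψ hφ]
          exact mem_iInter.2 fun k => (hp k).1
        rwa [huniq p h1 (le_antisymm (hp 0).2
          (csInf_le (D.bddBelow_cost_image _) (mem_image_of_mem _ h1)))])
  rw [prod_atTop_atTop_eq]
  refine mem_map.2 ?_
  filter_upwards [eventually_ge_atTop ((k.succPNat, k.succPNat) : ℕ+ × ℕ+)] with p hp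
  have h1 : ∀ j : ℕ+, k.succPNat ≤ j → k ≤ j := fun j hj =>
    (Nat.le_succ k).trans (show (k.succPNat : ℕ) ≤ j from hj)
  exact hk ⟨D.tildeWNM_anti (h1 _ hp.1) (h1 _ hp.2) (hq p), hc p⟩

/-- Complementary slackness in the averaged problem. -/
theorem exists_mem_graphWM_eq (hψ : ∀ i, ContDiff ℝ 1 (ψ i)) (hφ : ∀ i, ContDiff ℝ 1 (φ i))
    {N M : ℕ} {ζ : EuclideanSpace ℝ (Fin n) → ℝ} (hζ : D.IsAvgDualSol ψ φ N M ζ) {p : D.SlowMeas}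
    (hp : p ∈ D.tildeWNM ψ φ N M) (hc : D.cost p = D.GNM ψ φ N M) {A : Set (D.FastMeas × D.Z)}
    (hA : 0 < (p : Measure (D.FastMeas × D.Z)) A) :
    ∃ q ∈ A, q ∈ D.graphWM φ M ∧
      D.GTilde q.1 q.2 + fderiv ℝ ζ q.2 (D.gTilde q.1 q.2) = D.GNM ψ φ N M := by
  have hζ1 := hζ.mem.contDiff hψ
  have hF := (apply_eq_one_iff_ae (D.isClosed_graphWM hφ M).measurableSet p).1 hp.1
  have hi1 := D.continuous_GTilde.integrable_of_compactSpace (p : Measure (D.FastMeas × D.Z))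
  have hi2 := (D.continuous_fderiv_gTilde hζ1).integrable_of_compactSpace
    (p : Measure (D.FastMeas × D.Z))
  have hi12 : Integrable (fun q => D.GTilde q.1 q.2 + fderiv ℝ ζ q.2 (D.gTilde q.1 q.2))
      (p : Measure (D.FastMeas × D.Z)) := hi1.add hi2
  have h0 : ∫ q, fderiv ℝ ζ q.2 (D.gTilde q.1 q.2) ∂(p : Measure (D.FastMeas × D.Z)) = 0 := by
    obtain ⟨c, rfl⟩ := hζ.mem
    exact integral_fderiv_linearCombination hψ
      (r := fun q : D.FastMeas × D.Z => (q.2 : EuclideanSpace ℝ (Fin n))) (by fun_prop)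
      D.continuous_gTilde p N c hp.2
  -- The dual slack is nonnegative on `graphWM`, and its mean is cost minus value because the ζ-term
  -- integrates to zero. It therefore vanishes almost everywhere.
  have h1 : ∫ q, (D.GTilde q.1 q.2 + fderiv ℝ ζ q.2 (D.gTilde q.1 q.2) - D.GNM ψ φ N M)
      ∂(p : Measure (D.FastMeas × D.Z)) = 0 := by
    rw [integral_sub hi12 (integrable_const _), integral_add hi1 hi2, h0, add_zero,
      integral_const, probReal_univ, one_smul, ← hc]
    exact sub_self _
  replace h1 := (integral_eq_zero_iff_of_nonneg_ae
    (by filter_upwards [hF] with q hq using sub_nonneg.2 (hζ.le q hq))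
    (hi12.sub (integrable_const _))).1 h1
  have h2 : ∃ᵐ q ∂(p : Measure (D.FastMeas × D.Z)), q ∈ A :=
    frequently_ae_mem_iff.2 hA.ne'
  obtain ⟨q, h3, h4, h5⟩ := (h2.and_eventually (hF.and h1)).exists
  exact ⟨q, h3, h4, sub_eq_zero.1 h5⟩

/-- Complementary slackness in the associated problem. -/
theorem exists_mem_forall_augCost_le (hφ : ∀ i, ContDiff ℝ 1 (φ i))
    {N M : ℕ} {ζ : EuclideanSpace ℝ (Fin n) → ℝ} (hζ : D.IsAvgDualSol ψ φ N M ζ) {μ : D.FastMeas}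
    {z : D.Z} (hμ : μ ∈ D.WM φ M z)
    (heq : D.GTilde μ z + fderiv ℝ ζ z (D.gTilde μ z) = D.GNM ψ φ N M)
    {η : EuclideanSpace ℝ (Fin m) → ℝ} (hη : D.IsAssocDualSol φ M ζ z η) {B : Set (U × D.Y)}
    (hB : 0 < (μ : Measure (U × D.Y)) B) :
    ∃ x ∈ B, ∀ v, D.augCost ζ η x.1 x.2 z ≤ D.augCost ζ η v x.2 z := by
  have hη1 := hη.mem.contDiff hφ
  have hcG := D.continuous_G_right z
  have hcg : Continuous fun x : U × D.Y => fderiv ℝ ζ z (D.g x.1 x.2 z) :=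
    (fderiv ℝ ζ z).continuous.comp (D.continuous_g_right z)
  have hcf : ∀ {h : EuclideanSpace ℝ (Fin m) → ℝ}, ContDiff ℝ 1 h →
      Continuous fun x : U × D.Y => fderiv ℝ h x.2 (D.f x.1 x.2 z) := fun hh =>
    continuous_fderiv_apply hh (by fun_prop) (D.continuous_f_right z)
  have hval : ∀ ν : D.FastMeas, ∫ x, (D.G x.1 x.2 z + fderiv ℝ ζ z (D.g x.1 x.2 z))
      ∂(ν : Measure (U × D.Y)) = D.GTilde ν z + fderiv ℝ ζ z (D.gTilde ν z) := fun ν => by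
    rw [integral_add (hcG.integrable_of_compactSpace _) (hcg.integrable_of_compactSpace _),
      ← D.clm_gTilde]
    rfl
  obtain ⟨σ, hσ, hσle⟩ := hη.le
  -- The dual inequality for ζ bounds the fast linear program at z below by the averaged value. By
  -- duality every smaller number is attainable with some η', and only the supremum σ matters.
  have hge : D.GNM ψ φ N M ≤ σ := by
    refine le_of_forall_lt_imp_le_of_dense fun w hw => ?_
    obtain ⟨c, hc⟩ := exists_multiplier (M := M) (hcG.add hcg)
      (k := fun i x => fderiv ℝ (φ i) x.2 (D.f x.1 x.2 z)) (fun i => hcf (hφ i))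
      (v := D.GNM ψ φ N M) (fun ν hν => by
        simp only [Pi.add_apply]; rw [hval]; exact hζ.le (ν, z) hν) ⟨μ, hμ⟩ hw
    refine hσ.1 ⟨_, ⟨c, rfl⟩, fun u y => ?_⟩
    have := hc (u, y)
    simp only [augCost, fderiv_linearCombination hφ, _root_.sum_apply,
      _root_.smul_apply, smul_eq_mul]
    exact this
  have h0 : ∫ x, fderiv ℝ η x.2 (D.f x.1 x.2 z) ∂(μ : Measure (U × D.Y)) = 0 := by
    obtain ⟨c, rfl⟩ := hη.mem
    exact integral_fderiv_linearCombination hφ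
      (r := fun x : U × D.Y => (x.2 : EuclideanSpace ℝ (Fin m))) (by fun_prop)
      (D.continuous_f_right z) μ M c hμ
  have hi : Integrable (fun x : U × D.Y => D.augCost ζ η x.1 x.2 z) (μ : Measure (U × D.Y)) :=
    ((hcG.add hcg).add (hcf hη1)).integrable_of_compactSpace _
  -- The augmented cost is everywhere at least the averaged value and has exactly this mean, so
  -- μ-almost every point is a global minimizer.
  have h1 : ∫ x, (D.augCost ζ η x.1 x.2 z - D.GNM ψ φ N M) ∂(μ : Measure (U × D.Y)) = 0 := by
    rw [integral_sub hi (integrable_const _), integral_const, probReal_univ, one_smul]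
    simp only [augCost]
    rw [integral_add (f := fun x : U × D.Y => D.G x.1 x.2 z + fderiv ℝ ζ z (D.g x.1 x.2 z))
      ((hcG.add hcg).integrable_of_compactSpace _) ((hcf hη1).integrable_of_compactSpace _), h0,
      add_zero, hval, heq, sub_self]
  rw [integral_eq_zero_iff_of_nonneg (fun x => sub_nonneg.2 (hge.trans (hσle _ _)))
    (hi.sub (integrable_const _) :)] at h1
  obtain ⟨x, hx, hx'⟩ := ((frequently_ae_mem_iff.2 hB.ne').and_eventually h1).exists
  refine ⟨x, hx, fun v => ?_⟩
  rw [sub_eq_zero.1 hx']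
  exact hge.trans (hσle _ _)

end TestFunctions

end SPSystem

end SPAveraging

/-! ### Consistent metrics and limits of time averages. -/

namespace SPAveraging

section ConsistentMetric

variable {X : Type*} [TopologicalSpace X] {ρ : X → X → ℝ}

theorem IsConsistentMetric.self (hρ : IsConsistentMetric ρ) (a : X) : ρ a a = 0 :=
  (hρ.eq_zero_iff a a).2 rfl

theorem IsConsistentMetric.nonneg (hρ : IsConsistentMetric ρ) (a b : X) : 0 ≤ ρ a b := by
  have h := hρ.triangle a b a
  rw [hρ.self, hρ.symm b a] at h
  linarith

/-- Consistency is stated for sequences; first countability upgrades it to neighbourhood filters, as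
needed for limits along `iterFilter`. -/
theorem IsConsistentMetric.nhds_eq_comap [FirstCountableTopology X] (hρ : IsConsistentMetric ρ)
    (a : X) : 𝓝 a = comap (fun x => ρ x a) (𝓝 0) := by
  apply le_antisymm
  · rw [← tendsto_iff_comap]
    exact tendsto_of_seq_tendsto fun x hx => (hρ.tendsto_iff x a).1 hx
  · have : Tendsto id (comap (fun x => ρ x a) (𝓝 0)) (𝓝 a) :=
      tendsto_of_seq_tendsto fun x hx => (hρ.tendsto_iff x a).2 (tendsto_comap_iff.1 hx)
    exact this

theorem IsConsistentMetric.tendsto_nhds_iff [FirstCountableTopology X]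
    (hρ : IsConsistentMetric ρ) {ι : Type*} {l : Filter ι} {x : ι → X} {a : X} :
    Tendsto x l (𝓝 a) ↔ Tendsto (fun i => ρ (x i) a) l (𝓝 0) := by
  rw [hρ.nhds_eq_comap, tendsto_comap_iff]
  rfl

theorem IsConsistentMetric.exists_setOf_add_dist_lt_subset [FirstCountableTopology X]
    (hρ : IsConsistentMetric ρ) {Z : Type*} [PseudoMetricSpace Z] {a : X} {z : Z} {A : Set (X × Z)}
    (hA : A ∈ 𝓝 (a, z)) : ∃ r > 0, {q : X × Z | ρ q.1 a + dist q.2 z < r} ⊆ A := by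
  rw [nhds_prod_eq, mem_prod_iff] at hA
  obtain ⟨s, hs, t, ht, hst⟩ := hA
  rw [hρ.nhds_eq_comap, mem_comap] at hs
  obtain ⟨s', hs', hs⟩ := hs
  obtain ⟨r₁, hr₁, h₁⟩ := Metric.mem_nhds_iff.1 hs'
  obtain ⟨r₂, hr₂, h₂⟩ := Metric.mem_nhds_iff.1 ht
  refine ⟨min r₁ r₂, lt_min hr₁ hr₂, fun q hq => hst ⟨hs (h₁ ?_), h₂ ?_⟩⟩
  · have h0 := hρ.nonneg q.1 a
    rw [Metric.mem_ball, Real.dist_eq, sub_zero, abs_of_nonneg h0]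
    have : ρ q.1 a + dist q.2 z < min r₁ r₂ := hq
    linarith [min_le_left r₁ r₂, dist_nonneg (x := q.2) (y := z)]
  · have h0 := hρ.nonneg q.1 a
    have : ρ q.1 a + dist q.2 z < min r₁ r₂ := hq
    rw [Metric.mem_ball]
    linarith [min_le_right r₁ r₂]

end ConsistentMetric

theorem toMeasure_pos_iff {X : Type*} [MeasurableSpace X] {ν : ProbabilityMeasure X} {s : Set X} :
    0 < (ν : Measure X) s ↔ 0 < ν s := by
  rw [← ProbabilityMeasure.ennreal_coeFn_eq_coeFn_toMeasure, ENNReal.coe_pos]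

section TimeAverages

/-- Continuity off a null set suffices. It serves for the feedback along the optimal fast
trajectory, the feedback not being assumed measurable. -/
theorem aemeasurable_of_ae_continuousWithinAt {X : Type*} [TopologicalSpace X] [MeasurableSpace X]
    [BorelSpace X] {w : ℝ → X}
    (hw : ∀ᵐ t ∂timeMeasure, ContinuousWithinAt w (Ici 0) t) : AEMeasurable w timeMeasure := by
  obtain ⟨s, hs, hsm, hs0⟩ := exists_measurable_superset_of_null (mem_ae_iff.1 hw)
  have hae : ∀ᵐ t ∂timeMeasure, t ∈ Ici (0 : ℝ) ∩ sᶜ := by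
    filter_upwards [ae_restrict_mem measurableSet_Ici,
      (mem_ae_iff.2 (by rwa [compl_compl]) : sᶜ ∈ ae timeMeasure)] with t h1 h2 using ⟨h1, h2⟩
  have hc : ContinuousOn w (Ici 0 ∩ sᶜ) := fun t ht =>
    ContinuousWithinAt.mono (not_not.1 fun h => ht.2 (hs h)) inter_subset_left
  have h1 := hc.aemeasurable (μ := timeMeasure) (measurableSet_Ici.inter hsm.compl)
  rwa [Measure.restrict_eq_self_of_ae_mem hae] at h1

theorem aemeasurable_of_continuousOn {X : Type*} [TopologicalSpace X] [MeasurableSpace X]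
    [BorelSpace X] {w : ℝ → X} (hw : ContinuousOn w (Ici 0)) : AEMeasurable w timeMeasure :=
  hw.aemeasurable measurableSet_Ici

/-- Exchange of limits: the uniform rate permits fixing one large T, at which the averages converge.
-/
theorem tendsto_of_uniform_rate {ι : Type*} {l : Filter ι} {a : ι → ℝ → ℝ} {A : ι → ℝ}
    {b : ℝ → ℝ} {B : ℝ} {r : ℝ → ℝ} (hr : Tendsto r atTop (𝓝 0))
    (hA : ∀ i, ∀ T > 0, |a i T - A i| ≤ r T) (hb : Tendsto b atTop (𝓝 B))
    (hab : ∀ T > 0, Tendsto (fun i => a i T) l (𝓝 (b T))) : Tendsto A l (𝓝 B) := by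
  rw [Metric.tendsto_nhds]
  intro ε hε
  have h3 : 0 < ε / 3 := by positivity
  obtain ⟨T, hT0, hrT, hbT⟩ := ((eventually_gt_atTop 0).and ((hr.eventually_lt_const h3).and
    (Metric.tendsto_nhds.1 hb _ h3))).exists
  filter_upwards [Metric.tendsto_nhds.1 (hab T hT0) _ h3] with i hi
  have h1 := (hA i T hT0).trans_lt hrT
  rw [Real.dist_eq] at hbT hi ⊢
  rw [abs_lt] at *
  constructor <;> linarith

variable {X : Type*} [TopologicalSpace X] [CompactSpace X] [TopologicalSpace.MetrizableSpace X]
  [MeasurableSpace X] [BorelSpace X]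

theorem tendsto_timeAvg {w : ℕ+ × ℕ+ → ℝ → X} {w' : ℝ → X}
    (hw : ∀ p, AEMeasurable (w p) timeMeasure) (hw' : AEMeasurable w' timeMeasure)
    (hlim : ∀ᵐ t ∂timeMeasure, Tendsto (fun p => w p t) iterFilter (𝓝 (w' t))) (h : C(X, ℝ))
    {T : ℝ} (hT : 0 < T) :
    Tendsto (fun p => timeAvg (fun t => h (w p t)) T) iterFilter
      (𝓝 (timeAvg (fun t => h (w' t)) T)) := by
  unfold timeAvg
  refine Tendsto.const_mul _ ?_
  simp only [intervalIntegral.integral_of_le hT.le]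
  refine tendsto_integral_iterFilter (C := ‖h‖)
    (fun p => h.continuous.measurable.comp_aemeasurable
      ((hw p).mono_measure timeMeasure_restrict_le))
    (h.continuous.measurable.comp_aemeasurable (hw'.mono_measure timeMeasure_restrict_le))
    (fun p => ae_of_all _ fun t => h.norm_coe_le_norm _) (ae_of_all _ fun t => h.norm_coe_le_norm _)
    ?_
  filter_upwards [ae_mono timeMeasure_restrict_le hlim] with t ht
  exact (h.continuous.tendsto _).comp ht

/-- Pointwise convergence of trajectories, whose time averages converge at uniform rates, implies
convergence of the occupational measures. -/
theorem tendsto_occupationalMeasure {w : ℕ+ × ℕ+ → ℝ → X} {w' : ℝ → X}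
    (hw : ∀ p, AEMeasurable (w p) timeMeasure)
    (hlim : ∀ᵐ t ∂timeMeasure, Tendsto (fun p => w p t) iterFilter (𝓝 (w' t)))
    {ν : ℕ+ × ℕ+ → ProbabilityMeasure X} {ν' : ProbabilityMeasure X}
    (hν : ∀ h : C(X, ℝ), ∃ r : ℝ → ℝ, Tendsto r atTop (𝓝 0) ∧ ∀ p, ∀ T > 0,
      |timeAvg (fun t => h (w p t)) T - ∫ x, h x ∂(ν p : Measure X)| ≤ r T)
    (hν' : IsOccupationalMeasure w' ν') : Tendsto ν iterFilter (𝓝 ν') := by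
  rw [ProbabilityMeasure.tendsto_iff_forall_integral_tendsto]
  intro h
  obtain ⟨r, hr, hrb⟩ := hν h.toContinuousMap
  exact tendsto_of_uniform_rate hr hrb (hν'.tendsto h.toContinuousMap)
    fun T hT => tendsto_timeAvg hw hν'.aemeasurable hlim _ hT

end TimeAverages

/-! ### Convergence of the feedback on the supports of the optimal measures. -/

variable {U : Type*} [MetricSpace U] [CompactSpace U] [MeasurableSpace U] [BorelSpace U] {m n : ℕ}

namespace SPSystem

variable {D : SPSystem U m n}

theorem exists_bound_f (D : SPSystem U m n) :
    ∃ C : ℝ, ∀ (u : U) (y : D.Y) (z : D.Z), ‖D.f u y z‖ ≤ C := by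
  obtain ⟨C, hC⟩ := isCompact_univ.exists_bound_of_continuousOn D.continuous_f'.continuousOn
  exact ⟨C, fun u y z => hC ((u, y), z) (mem_univ _)⟩

theorem AdmissibleAssoc.continuousOn {z : D.Z} {u : ℝ → U} {y : ℝ → D.Y}
    (h : D.AdmissibleAssoc z u y) : ContinuousOn y (Ici 0) :=
  IsInducing.subtypeVal.continuousOn_iff.2 h.solution.continuousOn

/-- The feedback built from the approximating dual problems is close to the optimal control at
points of the supports of the optimal measures. -/
theorem Scheme.tendsto_feedback (S : D.Scheme) {ρ : D.FastMeas → D.FastMeas → ℝ}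
    (hρ : IsConsistentMetric ρ) {pStar : D.SlowMeas} {μStar : ℝ → D.FastMeas} {zStar : ℝ → D.Z}
    (hopt : D.OptimalPair ρ pStar μStar zStar) {μ₀ : D.FastMeas} {z₀ : D.Z} {u₀ : U} {y₀ : D.Y}
    (hμ₀ : ∀ r > 0, 0 < pStar {q | ρ q.1 μ₀ + dist q.2 z₀ < r})
    (hu₀ : ∀ r > 0, 0 < μ₀ {x | dist x.1 u₀ + dist x.2 y₀ < r}) {rQ rB L : ℝ} (hrQ : 0 < rQ)
    (hrB : 0 < rB)
    (huniq : ∀ N M, ∀ y ∈ Metric.ball y₀ rB, ∀ z ∈ Metric.ball z₀ rQ, ∀ v : U,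
      (∀ w, D.augCost (S.ζ N M) (S.η N M z) v y z ≤ D.augCost (S.ζ N M) (S.η N M z) w y z) →
      v = S.feedback N M y z)
    (hlip : ∀ N M, ∀ y' ∈ Metric.ball y₀ rB, ∀ y'' ∈ Metric.ball y₀ rB,
      ∀ z' ∈ Metric.ball z₀ rQ, ∀ z'' ∈ Metric.ball z₀ rQ,
      dist (S.feedback N M y' z') (S.feedback N M y'' z'') ≤ L * (dist y' y'' + dist z' z'')) :
    Tendsto (fun p : ℕ+ × ℕ+ => dist (S.feedback p.1 p.2 y₀ z₀) u₀) (atTop ×ˢ atTop) (𝓝 0) := by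
  -- `pStar` is feasible for every approximating program, which is thus solvable with value at most
  -- `GStar`.
  have hmem : ∀ p : ℕ+ × ℕ+, pStar ∈ D.tildeWNM S.ψ S.φ p.1 p.2 := fun p => by
    have h := hopt.p_mem
    rw [D.tildeW_eq_iInter S.approx_ψ S.approx_φ, mem_iInter] at h
    exact D.tildeWNM_anti (le_max_left _ _) (le_max_right _ _) (h (max p.1 p.2 : ℕ))
  choose π hπ hπc using fun p : ℕ+ × ℕ+ => D.exists_mem_tildeWNM_cost_eq S.approx_ψ.contDiff
    S.approx_φ.contDiff ⟨pStar, hmem p⟩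
  have hπlim := D.tendsto_of_mem_tildeWNM S.approx_ψ S.approx_φ hopt.p_unique hπ fun p => by
    rw [hπc, ← hopt.p_opt]
    exact csInf_le (D.bddBelow_cost_image _) (mem_image_of_mem _ (hmem p))
  rw [Metric.tendsto_nhds]
  intro ε hε
  -- One `r` is spent on the distance of the minimizing control to `u₀`, and `|L| * (r + r)` on
  -- moving the feedback from the nearby tight point to `(y₀, z₀)`.
  obtain ⟨r, hr0, hrε, hrrB, hrrQ⟩ : ∃ r > 0, r + |L| * (r + r) < ε ∧ r ≤ rB ∧ r ≤ rQ := by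
    refine ⟨min (min rB rQ) (ε / (2 * (1 + 2 * |L|))), by positivity, ?_,
      (min_le_left _ _).trans (min_le_left _ _), (min_le_left _ _).trans (min_le_right _ _)⟩
    have h1 := min_le_right (min rB rQ) (ε / (2 * (1 + 2 * |L|)))
    rw [le_div_iff₀ (by positivity)] at h1
    nlinarith
  let B : Set (U × D.Y) := {x | dist x.1 u₀ + dist x.2 y₀ < r}
  have hB : IsOpen B := isOpen_lt (by fun_prop) continuous_const
  let A : Set (D.FastMeas × D.Z) :=
    {μ : D.FastMeas | 0 < (μ : Measure (U × D.Y)) B} ×ˢ Metric.ball z₀ r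
  have hAo : IsOpen A := (isOpen_setOf_measure_pos hB).prod Metric.isOpen_ball
  have hA : A ∈ 𝓝 (μ₀, z₀) := by
    refine hAo.mem_nhds ⟨?_, Metric.mem_ball_self hr0⟩
    exact toMeasure_pos_iff.2 (hu₀ r hr0)
  obtain ⟨r', hr', hr'A⟩ := hρ.exists_setOf_add_dist_lt_subset hA
  have hpA : 0 < (pStar : Measure (D.FastMeas × D.Z)) A :=
    toMeasure_pos_iff.2 ((hμ₀ r' hr').trans_le (pStar.apply_mono hr'A))
  filter_upwards [hπlim.eventually ((isOpen_setOf_measure_pos hAo).mem_nhds hpA)] with p hp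
  obtain ⟨q, hqA, hqF, hq⟩ := D.exists_mem_graphWM_eq S.approx_ψ.contDiff S.approx_φ.contDiff
    (S.ζ_sol p.1 p.2) (hπ p) (hπc p) hp
  obtain ⟨x, hxB, hx⟩ := D.exists_mem_forall_augCost_le S.approx_φ.contDiff (S.ζ_sol p.1 p.2)
    hqF hq (S.η_sol p.1 p.2 q.2) hqA.1
  have hxB : dist x.1 u₀ + dist x.2 y₀ < r := hxB
  have hx1 := dist_nonneg (x := x.1) (y := u₀)
  have hx2 := dist_nonneg (x := x.2) (y := y₀)
  have hz : dist q.2 z₀ < r := hqA.2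
  have hyb : x.2 ∈ Metric.ball y₀ rB := by rw [Metric.mem_ball]; linarith
  have hzb : q.2 ∈ Metric.ball z₀ rQ := hz.trans_le hrrQ
  -- Slackness only says that `x.1` is some minimizer; uniqueness identifies it with the feedback.
  have hxu := huniq p.1 p.2 _ hyb _ hzb _ hx
  have hl := hlip p.1 p.2 _ (Metric.mem_ball_self hrB) _ hyb _ (Metric.mem_ball_self hrQ) _ hzb
  rw [← hxu] at hl
  rw [dist_zero_right, Real.norm_of_nonneg dist_nonneg]
  have h1 : L * (dist y₀ x.2 + dist z₀ q.2) ≤ |L| * (r + r) := by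
    refine (mul_le_mul_of_nonneg_right (le_abs_self L) (by positivity)).trans ?_
    rw [dist_comm y₀, dist_comm z₀]
    gcongr
    linarith
  linarith [dist_triangle (S.feedback p.1 p.2 y₀ z₀) x.1 u₀]

end SPSystem

end SPAveraging

/-! ### Convergence of the fast motions and of their occupational measures. -/

namespace SPAveraging

variable {U : Type*} [MetricSpace U] [CompactSpace U] [MeasurableSpace U] [BorelSpace U] {m n : ℕ}

namespace SPSystem

variable {D : SPSystem U m n}

/-- The closed-loop trajectories that start on the optimal fast trajectory converge to it,
together with their controls. -/
theorem Scheme.tendsto_closedLoop (S : D.Scheme)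
    (hfu : ∃ L : ℝ, ∀ u u', ∀ y ∈ D.Y, ∀ z ∈ D.Z, ‖D.f u y z - D.f u' y z‖ ≤ L * dist u u')
    {z₀ : D.Z} {u' : ℝ → U} {y' : ℝ → D.Y} (hadm : D.AdmissibleAssoc z₀ u' y') {rB : ℝ → ℝ} {L : ℝ}
    (hrB : ∀ᵐ τ ∂timeMeasure, 0 < rB τ)
    (hlip : ∀ᵐ τ ∂timeMeasure, ∀ N M, ∀ y₁ ∈ Metric.ball (y' τ) (rB τ),
      ∀ y₂ ∈ Metric.ball (y' τ) (rB τ),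
      dist (S.feedback N M y₁ z₀) (S.feedback N M y₂ z₀) ≤ L * dist y₁ y₂)
    (hfb : ∀ᵐ τ ∂timeMeasure,
      Tendsto (fun p : ℕ+ × ℕ+ => dist (S.feedback p.1 p.2 (y' τ) z₀) (u' τ)) iterFilter (𝓝 0))
    (hsmall : ∀ T > 0, Tendsto (fun p : ℕ+ × ℕ+ => volume {τ | τ ∈ Icc 0 T ∧
      S.traj p.1 p.2 z₀ (y' 0) τ ∉ Metric.ball (y' τ) (rB τ)}) iterFilter (𝓝 0)) :
    ∀ᵐ τ ∂timeMeasure, Tendsto (fun p : ℕ+ × ℕ+ =>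
      (S.feedback p.1 p.2 (S.traj p.1 p.2 z₀ (y' 0) τ) z₀, S.traj p.1 p.2 z₀ (y' 0) τ))
      iterFilter (𝓝 (u' τ, y' τ)) := by
  obtain ⟨Lu, hLu⟩ := hfu
  obtain ⟨Lf, hLf⟩ := D.lipschitz_f
  obtain ⟨C, hC⟩ := D.exists_bound_f
  have hy' := hadm.continuousOn
  have hdiam : ∀ a b : U, dist a b ≤ Metric.diam (univ : Set U) := fun a b =>
    Metric.dist_le_diam_of_mem isCompact_univ.isBounded (mem_univ a) (mem_univ b)
  have hcl := fun p : ℕ+ × ℕ+ => S.traj_sol p.1 p.2 z₀ (y' 0)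
  have hfm : ∀ p : ℕ+ × ℕ+, AEMeasurable (fun τ => S.feedback p.1 p.2 (y' τ) z₀) timeMeasure := by
    intro p
    refine aemeasurable_of_ae_continuousWithinAt ?_
    filter_upwards [hrB, hlip, ae_restrict_mem measurableSet_Ici] with τ h1 h2 hτ
    have h3 : Tendsto (fun s => L * dist (y' s) (y' τ)) (𝓝[Ici 0] τ) (𝓝 0) := by
      simpa using (tendsto_iff_dist_tendsto_zero.1 (hy' τ hτ)).const_mul L
    refine tendsto_iff_dist_tendsto_zero.2 (squeeze_zero' (Eventually.of_forall fun _ =>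
      dist_nonneg) ?_ h3)
    filter_upwards [(hy' τ hτ).eventually (Metric.ball_mem_nhds _ h1)] with s hs
    exact h2 p.1 p.2 _ hs _ (Metric.mem_ball_self h1)
  have hbnd : ∀ p : ℕ+ × ℕ+, ∀ᵐ τ ∂timeMeasure, 0 < rB τ →
      S.traj p.1 p.2 z₀ (y' 0) τ ∈ Metric.ball (y' τ) (rB τ) →
      dist (S.feedback p.1 p.2 (S.traj p.1 p.2 z₀ (y' 0) τ) z₀) (u' τ)
        ≤ |L| * dist (S.traj p.1 p.2 z₀ (y' 0) τ) (y' τ)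
          + dist (S.feedback p.1 p.2 (y' τ) z₀) (u' τ) := by
    intro p
    filter_upwards [hlip] with τ h1 h2 h3
    refine (dist_triangle _ (S.feedback p.1 p.2 (y' τ) z₀) _).trans (add_le_add_left ?_ _)
    exact (h1 p.1 p.2 _ h3 _ (Metric.mem_ball_self h2)).trans (by gcongr; exact le_abs_self L)
  have htraj : ∀ τ, 0 ≤ τ → Tendsto (fun p : ℕ+ × ℕ+ => S.traj p.1 p.2 z₀ (y' 0) τ) iterFilter
      (𝓝 (y' τ)) := by
    intro τ hτ
    rw [tendsto_iff_dist_tendsto_zero]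
    simp only [Subtype.dist_eq, dist_eq_norm]
    -- `K` collects the Lipschitz constant of `f` in y and that of `f` in u times that of the
    -- feedback. The discrepancy left over is the feedback error on the optimal trajectory.
    refine tendsto_norm_sub_of_perturbation (K := |Lf| + |Lu| * |L|)
      (C := max (C + C) (|Lu| * Metric.diam (univ : Set U)))
      (fun p => (hcl p).admissible.solution) hadm.solution (fun p => by rw [(hcl p).init])
      (by positivity)
      (δ := fun p τ => |Lu| * dist (S.feedback p.1 p.2 (y' τ) z₀) (u' τ))
      (fun p => ((hfm p).dist hadm.aemeasurable).const_mul _)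
      (fun p s => by positivity)
      (fun p s => le_max_of_le_right (by gcongr; exact hdiam _ _)) ?_
      (bad := fun p => {τ | S.traj p.1 p.2 z₀ (y' 0) τ ∉ Metric.ball (y' τ) (rB τ)}) hsmall
      (fun p => ae_of_all _ fun s => le_max_of_le_left
        ((norm_sub_le _ _).trans (add_le_add (hC _ _ _) (hC _ _ _)))) ?_ hτ
    · filter_upwards [hfb] with s hs
      simpa using hs.const_mul |Lu|
    · intro p
      filter_upwards [hbnd p, hrB] with s h1 h2 h3
      have h4 := h1 h2 (not_not.1 h3)
      rw [Subtype.dist_eq, dist_eq_norm] at h4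
      set w := S.feedback p.1 p.2 (S.traj p.1 p.2 z₀ (y' 0) s) z₀
      set x := S.traj p.1 p.2 z₀ (y' 0) s
      have h5 := hLf w x x.2 (y' s) (y' s).2 z₀ z₀.2 z₀ z₀.2
      rw [sub_self, norm_zero, add_zero] at h5
      have h6 := hLu w (u' s) (y' s) (y' s).2 z₀ z₀.2
      have h7 : Lf * ‖(x : EuclideanSpace ℝ (Fin m)) - y' s‖
          ≤ |Lf| * ‖(x : EuclideanSpace ℝ (Fin m)) - y' s‖ := by gcongr; exact le_abs_self _
      have h8 : Lu * dist w (u' s) ≤ |Lu| * (|L| * ‖(x : EuclideanSpace ℝ (Fin m)) - y' s‖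
          + dist (S.feedback p.1 p.2 (y' s) z₀) (u' s)) :=
        mul_le_mul (le_abs_self _) h4 dist_nonneg (abs_nonneg _)
      have h9 := norm_sub_le_norm_sub_add_norm_sub (D.f w x z₀) (D.f w (y' s) z₀)
        (D.f (u' s) (y' s) z₀)
      linarith
  filter_upwards [ae_all_iff.2 hbnd, hrB, hfb, ae_restrict_mem measurableSet_Ici]
    with τ h1 h2 h3 hτ
  have h4 := htraj τ hτ
  refine Tendsto.prodMk_nhds (tendsto_iff_dist_tendsto_zero.2 ?_) h4
  have h5 : Tendsto (fun p : ℕ+ × ℕ+ => |L| * dist (S.traj p.1 p.2 z₀ (y' 0) τ) (y' τ)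
      + dist (S.feedback p.1 p.2 (y' τ) z₀) (u' τ)) iterFilter (𝓝 0) := by
    simpa using ((tendsto_iff_dist_tendsto_zero.1 h4).const_mul |L|).add h3
  refine squeeze_zero' (Eventually.of_forall fun _ => dist_nonneg) ?_ h5
  -- At a fixed time, convergence of the trajectories eventually places them inside the ball, so bad
  -- times no longer matter.
  filter_upwards [h4.eventually (Metric.ball_mem_nhds _ h2)] with p hp
  exact h1 p h2 hp

/-- The occupational measures generated by the feedback at `zStar t` converge to `μStar t`. -/
theorem Scheme.GeneratesACG.tendsto_occupational {S : D.Scheme}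
    {ρ : D.FastMeas → D.FastMeas → ℝ} (hρ : IsConsistentMetric ρ)
    (hfu : ∃ L : ℝ, ∀ u u', ∀ y ∈ D.Y, ∀ z ∈ D.Z, ‖D.f u y z - D.f u' y z‖ ≤ L * dist u u')
    {pStar : D.SlowMeas} {μStar : ℝ → D.FastMeas} {zStar : ℝ → D.Z}
    (hopt : D.OptimalPair ρ pStar μStar zStar) {uStar : ℝ → ℝ → U} {yStar : ℝ → ℝ → D.Y}
    (hfast : D.OptimalFastPair μStar zStar uStar yStar)
    {y₀ : ℕ+ → ℕ+ → D.Z → D.Y} {μNM : ℕ+ → ℕ+ → D.Z → D.FastMeas}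
    {zNM : ℕ+ → ℕ+ → D.Z → ℝ → D.Z} {lam : ℕ+ → ℕ+ → D.SlowMeas}
    {V : ℕ+ → ℕ+ → ℝ → Set D.Y} {O : ℕ+ → ℕ+ → Set D.Z}
    {rate : C(U × D.Y × D.Z, ℝ) → ℝ → ℝ} {slowRate : C(D.FastMeas × D.Z, ℝ) → ℝ → ℝ}
    (hacg : S.GeneratesACG zStar yStar y₀ μNM zNM lam V O rate slowRate)
    {rQ : ℝ → ℝ} (hrQ : ∀ᵐ t ∂timeMeasure, 0 < rQ t)
    {rB : ℝ → ℝ → ℝ} (hreg : D.FastRegularity S zStar yStar rQ rB) :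
    ∀ᵐ t ∂timeMeasure,
      Tendsto (fun p : ℕ+ × ℕ+ => μNM p.1 p.2 (zStar t)) iterFilter (𝓝 (μStar t)) := by
  filter_upwards [hrQ, hopt.support, hfast.admissible, hfast.occupational, hfast.support,
    hacg.indep, hreg.unique, hreg.lipschitz, hreg.small] with t hQ hsupp hadm hocc hsupp' hind
    huniq hlip hsmall
  obtain ⟨L, hL⟩ := hlip hQ
  have hz := Metric.mem_ball_self (x := zStar t) hQ
  -- The start `yStar t 0` lies in `V N M t`, so the closed-loop solution from there generates the
  -- same measure as the family.
  have hmem := fun N M => mem_of_mem_nhds ((hind N M).1 0 le_rfl)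
  have hconv := S.tendsto_closedLoop hfu hadm (rB := rB t) (L := L)
    ((huniq hQ).mono fun τ h => h.1)
    (hL.mono fun τ h N M y₁ h₁ y₂ h₂ => by simpa using h N M y₁ h₁ y₂ h₂ _ hz _ hz) (by
      filter_upwards [hsupp', huniq hQ, hL] with τ h1 h2 h3
      exact (S.tendsto_feedback hρ hopt hsupp h1 hQ h2.1 h2.2 h3).mono_left iterFilter_le)
    fun T hT => iterLimZero_coe_ennreal_iff.1 (hsmall hQ T hT)
  refine tendsto_occupationalMeasure (fun p => ((hind p.1 p.2).2 _ (hmem _ _)).1.aemeasurable) hconv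
    -- The rates concern test functions on U × Y × Z; one on U × Y is pulled back along the
    -- projection.
    (fun h => ⟨rate (h.comp ⟨fun x : U × D.Y × D.Z => (x.1, x.2.1), by fun_prop⟩),
      hacg.rate_tendsto _, fun p T hT => ?_⟩) hocc
  exact ((hind p.1 p.2).2 _ (hmem _ _)).2
    (h.comp ⟨fun x : U × D.Y × D.Z => (x.1, x.2.1), by fun_prop⟩) T hT

end SPSystem

end SPAveraging

/-! ### Existence of occupational measures and convergence of the slow motions. -/

namespace SPAveraging

section OccupationalMeasures

variable {X : Type*} [TopologicalSpace X] [CompactSpace X] [TopologicalSpace.MetrizableSpace X]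
  [MeasurableSpace X] [BorelSpace X]

/-- The empirical measure of a trajectory over a bounded time interval. -/
theorem exists_empiricalMeasure {w : ℝ → X} (hw : AEMeasurable w timeMeasure) {T : ℝ} (hT : 0 < T) :
    ∃ ν : ProbabilityMeasure X,
      (∀ h : C(X, ℝ), ∫ x, h x ∂(ν : Measure X) = timeAvg (fun t => h (w t)) T) ∧
      ∀ A : Set X, MeasurableSet A → (∀ᵐ t ∂timeMeasure, w t ∈ A) → ν A = 1 := by
  have hw' : AEMeasurable w (volume.restrict (Ioc 0 T)) := hw.mono_measure timeMeasure_restrict_le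
  have hT' : ENNReal.ofReal T ≠ 0 := by simpa using hT
  refine ⟨⟨(ENNReal.ofReal T)⁻¹ • (volume.restrict (Ioc 0 T)).map w, ⟨?_⟩⟩, fun h => ?_,
    fun A hA hwA => ?_⟩
  · rw [Measure.smul_apply, Measure.map_apply_of_aemeasurable hw' MeasurableSet.univ,
      preimage_univ, Measure.restrict_apply_univ, Real.volume_Ioc, sub_zero, smul_eq_mul,
      ENNReal.inv_mul_cancel hT' ENNReal.ofReal_ne_top]
  · rw [ProbabilityMeasure.coe_mk, integral_smul_measure, integral_map hw'
      h.continuous.aestronglyMeasurable, timeAvg, intervalIntegral.integral_of_le hT.le,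
      ENNReal.toReal_inv, ENNReal.toReal_ofReal hT.le, smul_eq_mul]
  · refine (apply_eq_one_iff_ae hA _).2 ?_
    rw [ProbabilityMeasure.coe_mk]
    refine Measure.ae_smul_measure ?_ _
    exact (ae_map_iff hw' hA).2 (ae_mono timeMeasure_restrict_le hwA)

/-- If all time averages converge, then they are given by an occupational measure. -/
theorem exists_isOccupationalMeasure {w : ℝ → X} (hw : AEMeasurable w timeMeasure)
    (hlim : ∀ h : C(X, ℝ), ∃ l : ℝ, Tendsto (timeAvg fun t => h (w t)) atTop (𝓝 l)) :
    ∃ ν : ProbabilityMeasure X, IsOccupationalMeasure w ν ∧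
      ∀ A : Set X, IsClosed A → (∀ᵐ t ∂timeMeasure, w t ∈ A) → ν A = 1 := by
  choose e he he' using fun k : ℕ =>
    exists_empiricalMeasure hw (T := (k : ℝ) + 1) (Nat.cast_add_one_pos k)
  -- A subsequence of empirical measures converges by compactness; since all time averages converge,
  -- its limit integrates every test function to the full limit.
  obtain ⟨ν, s, hs, hν⟩ := CompactSpace.tendsto_subseq e
  refine ⟨ν, ⟨hw, fun h => ?_⟩, fun A hA hwA => ?_⟩
  · obtain ⟨l, hl⟩ := hlim h
    have h1 := ((continuous_integral_probabilityMeasure h.continuous).tendsto ν).comp hν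
    have h2 : Tendsto (fun k => ((s k : ℕ) : ℝ) + 1) atTop atTop :=
      tendsto_atTop_add_const_right _ _ (tendsto_natCast_atTop_atTop.comp hs.tendsto_atTop)
    have h3 := hl.comp h2
    simp only [Function.comp_def, he] at h1 h3
    rwa [tendsto_nhds_unique h1 h3]
  · exact (isClosed_setOf_apply_eq_one hA).mem_of_tendsto hν
      (Eventually.of_forall fun k => he' _ A hA.measurableSet hwA)

end OccupationalMeasures

variable {U : Type*} [MetricSpace U] [CompactSpace U] [MeasurableSpace U] [BorelSpace U] {m n : ℕ}

namespace SPSystem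

variable {D : SPSystem U m n}

/-- The optimal pair generates the optimal solution of the averaged IDLP problem. -/
theorem OptimalPair.isOccupationalMeasure {ρ : D.FastMeas → D.FastMeas → ℝ} {pStar : D.SlowMeas}
    {μStar : ℝ → D.FastMeas} {zStar : ℝ → D.Z} (hopt : D.OptimalPair ρ pStar μStar zStar)
    {φ : ℕ → EuclideanSpace ℝ (Fin m) → ℝ} (hφ : ApproximatesC1 φ D.Y) :
    IsOccupationalMeasure (fun t => (μStar t, zStar t)) pStar := by
  have hsol := hopt.admissible.solution
  have hz : ContinuousOn zStar (Ici 0) := IsInducing.subtypeVal.continuousOn_iff.2 hsol.continuousOn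
  obtain ⟨p, hp, hpA⟩ := exists_isOccupationalMeasure
    (hopt.admissible.aemeasurable.prodMk (aemeasurable_of_continuousOn hz)) hopt.limits
  have hW : IsClosed D.graphW := by
    rw [D.graphW_eq_iInter hφ]
    exact isClosed_iInter fun M => D.isClosed_graphWM hφ.contDiff M
  have hmem : p ∈ D.tildeW := by
    refine ⟨hpA _ hW hopt.admissible.mem_W, fun ψ hψ => ?_⟩
    have h1 := hp.tendsto ⟨_, D.continuous_fderiv_gTilde hψ⟩
    refine tendsto_nhds_unique h1 ?_
    -- The integrand is the derivative of ψ along the bounded trajectory, so its average over [0, T]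
    -- is at most `(C + C) / T`.
    obtain ⟨C, hC⟩ := D.isCompact_Z.exists_bound_of_continuousOn hψ.continuous.continuousOn
    have h2 : Tendsto (fun T : ℝ => T⁻¹ * (C + C)) atTop (𝓝 0) := by
      simpa using tendsto_inv_atTop_zero.mul_const (C + C)
    refine squeeze_zero_norm' ?_ h2
    filter_upwards [eventually_gt_atTop 0] with T hT
    simp only [timeAvg, ContinuousMap.coe_mk]
    rw [(hsol.integral_fderiv hψ hT).2, norm_mul, norm_inv, Real.norm_of_nonneg hT.le]
    gcongr
    exact (norm_sub_le _ _).trans (add_le_add (hC _ (zStar T).2) (hC _ (zStar 0).2))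
  have hcost : D.cost p = D.GStar := by
    rw [← hopt.values_eq, ← hopt.optimal]
    exact (hp.tendsto ⟨_, D.continuous_GTilde⟩).liminf_eq.symm
  rwa [← hopt.p_unique p hmem hcost]

/-- The ACG condition gives measurability of scalar integrals only, hence the passage to
coordinates. -/
theorem IsACG.measurable_gTilde {z₀ : D.Z} {u : D.Z → ℝ → U} {y : D.Z → ℝ → D.Y}
    {μ : D.Z → D.FastMeas} {zt : ℝ → D.Z} (h : D.IsACG z₀ u y μ zt) :
    Measurable fun z => D.gTilde (μ z) z := by
  have h1 : Measurable fun z => (EuclideanSpace.equiv (Fin n) ℝ) (D.gTilde (μ z) z) := by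
    refine measurable_pi_lambda _ fun i => ?_
    have h2 : ∀ z, (EuclideanSpace.equiv (Fin n) ℝ) (D.gTilde (μ z) z) i
        = ∫ x, (D.g x.1 x.2 z) i ∂(μ z : Measure (U × D.Y)) := fun z =>
      D.clm_gTilde (EuclideanSpace.proj i) (μ z) z
    simp only [h2]
    exact h.measurable ⟨fun x : U × D.Y × D.Z => (D.g x.1 x.2.1 x.2.2) i,
      ((EuclideanSpace.proj (𝕜 := ℝ) i).continuous).comp
        (D.continuous_g'.comp (f := fun x : U × D.Y × D.Z => ((x.1, x.2.1), x.2.2)) (by fun_prop))⟩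
  have h3 := (EuclideanSpace.equiv (Fin n) ℝ).symm.continuous.measurable.comp h1
  simpa [Function.comp_def] using h3

theorem exists_bound_gTilde (D : SPSystem U m n) :
    ∃ C : ℝ, ∀ (μ : D.FastMeas) (z : D.Z), ‖D.gTilde μ z‖ ≤ C := by
  obtain ⟨C, hC⟩ := isCompact_univ.exists_bound_of_continuousOn D.continuous_gTilde.continuousOn
  exact ⟨C, fun μ z => hC (μ, z) (mem_univ _)⟩

/-- The trajectories of the averaged system generated by the feedback converge to the optimal
one, together with the occupational measures of the fast motions. -/
theorem SlowRegularity.tendsto_avgTrajectory {ρ : D.FastMeas → D.FastMeas → ℝ}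
    (hρ : IsConsistentMetric ρ) {μStar : ℝ → D.FastMeas} {zStar : ℝ → D.Z}
    (hadm : D.AdmissibleAvg μStar zStar) {μNM : ℕ+ → ℕ+ → D.Z → D.FastMeas}
    {zNM : ℕ+ → ℕ+ → D.Z → ℝ → D.Z}
    (hm : ∀ N M, Measurable fun z => D.gTilde (μNM N M z) z)
    (htraj : ∀ N M, D.IsAvgTrajectory (μNM N M) (zStar 0) (zNM N M (zStar 0))) {rQ : ℝ → ℝ}
    (hslow : D.SlowRegularity ρ zStar μNM zNM rQ)
    (hμ : ∀ᵐ t ∂timeMeasure,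
      Tendsto (fun p : ℕ+ × ℕ+ => μNM p.1 p.2 (zStar t)) iterFilter (𝓝 (μStar t))) :
    ∀ᵐ t ∂timeMeasure, Tendsto (fun p : ℕ+ × ℕ+ =>
      (μNM p.1 p.2 (zNM p.1 p.2 (zStar 0) t), zNM p.1 p.2 (zStar 0) t)) iterFilter
      (𝓝 (μStar t, zStar t)) := by
  obtain ⟨L, hL⟩ := hslow.lipschitz
  obtain ⟨C, hC⟩ := D.exists_bound_gTilde
  have hz : ContinuousOn zStar (Ici 0) :=
    IsInducing.subtypeVal.continuousOn_iff.2 hadm.solution.continuousOn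
  have hzm := aemeasurable_of_continuousOn hz
  have hgm : AEMeasurable (fun t => D.gTilde (μStar t) (zStar t)) timeMeasure :=
    D.continuous_gTilde.measurable.comp_aemeasurable (hadm.aemeasurable.prodMk hzm)
  have hsub : ∀ μ z μ' z', ‖D.gTilde μ z - D.gTilde μ' z'‖ ≤ C + C := fun μ z μ' z' =>
    (norm_sub_le _ _).trans (add_le_add (hC _ _) (hC _ _))
  have hlim : ∀ t, 0 ≤ t →
      Tendsto (fun p : ℕ+ × ℕ+ => zNM p.1 p.2 (zStar 0) t) iterFilter (𝓝 (zStar t)) := by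
    intro t ht
    rw [tendsto_iff_dist_tendsto_zero]
    simp only [Subtype.dist_eq, dist_eq_norm]
    -- The Lipschitz bound on `Q_s` compares the two velocities through the feedback measure at
    -- `zStar s`; the remaining `δ` vanishes by `hμ` and continuity of g̃.
    refine tendsto_norm_sub_of_perturbation (K := |L|) (C := C + C)
      (fun p => (htraj p.1 p.2).solution) hadm.solution (fun p => by rw [(htraj p.1 p.2).init])
      (abs_nonneg L)
      (δ := fun p t => ‖D.gTilde (μNM p.1 p.2 (zStar t)) (zStar t)
        - D.gTilde (μStar t) (zStar t)‖)
      (fun p => (((hm p.1 p.2).comp_aemeasurable hzm).sub hgm).norm)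
      (fun p s => norm_nonneg _) (fun p s => hsub _ _ _ _) ?_
      (bad := fun p => {t' | zNM p.1 p.2 (zStar 0) t' ∉ Metric.ball (zStar t') (rQ t')})
      (fun T hT => iterLimZero_coe_ennreal_iff.1 (hslow.small T hT))
      (fun p => ae_of_all _ fun s => hsub _ _ _ _) ?_ ht
    · filter_upwards [hμ] with s hs
      rw [← tendsto_iff_norm_sub_tendsto_zero]
      exact (D.continuous_gTilde.tendsto (μStar s, zStar s)).comp
        (hs.prodMk_nhds tendsto_const_nhds)
    · intro p
      filter_upwards [hL, hslow.pos] with s h1 h2 h3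
      have h4 := h1 p.1 p.2 _ (not_not.1 h3) _ (Metric.mem_ball_self h2)
      refine (norm_sub_le_norm_sub_add_norm_sub _
        (D.gTilde (μNM p.1 p.2 (zStar s)) (zStar s)) _).trans (add_le_add_left (h4.trans ?_) _)
      rw [Subtype.dist_eq, dist_eq_norm]
      gcongr
      exact le_abs_self L
  filter_upwards [hμ, hslow.pos, hslow.continuity, ae_restrict_mem measurableSet_Ici]
    with t h1 h2 ⟨κ, hκ, hκb⟩ ht
  have h3 := hlim t ht
  refine Tendsto.prodMk_nhds (hρ.tendsto_nhds_iff.2 ?_) h3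
  have h4 : Tendsto (fun p : ℕ+ × ℕ+ =>
      ρ (μNM p.1 p.2 (zNM p.1 p.2 (zStar 0) t)) (μNM p.1 p.2 (zStar t))) iterFilter (𝓝 0) := by
    rw [Metric.tendsto_nhds]
    intro ε hε
    obtain ⟨δ, hδ, hκδ⟩ := mem_nhdsGT_iff_exists_Ioo_subset.1 (hκ.eventually_lt_const hε)
    have hδ : 0 < δ := hδ
    filter_upwards [h3.eventually (Metric.ball_mem_nhds _ (lt_min hδ h2))] with p hp
    have hp' := lt_min_iff.1 (Metric.mem_ball.1 hp)
    rw [Real.dist_eq, sub_zero, abs_of_nonneg (hρ.nonneg _ _)]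
    -- The modulus κ is controlled only at positive arguments, so coinciding points are treated
    -- apart.
    rcases (dist_nonneg (x := zNM p.1 p.2 (zStar 0) t) (y := zStar t)).eq_or_lt with h0 | h0
    · rwa [dist_eq_zero.1 h0.symm, hρ.self]
    · exact (hκb p.1 p.2 _ hp'.2 _ (Metric.mem_ball_self h2)).trans_lt (hκδ ⟨h0, hp'.1⟩)
  refine squeeze_zero (fun p => hρ.nonneg _ _)
    (fun p => hρ.triangle _ (μNM p.1 p.2 (zStar t)) _) ?_
  simpa using h4.add (hρ.tendsto_nhds_iff.1 h1)

end SPSystem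

end SPAveraging

/-! ### The main theorem. -/

theorem mainTheorem1 {U : Type*} [MetricSpace U] [CompactSpace U] [MeasurableSpace U] [BorelSpace U]
    {m n : ℕ} (D : SPAveraging.SPSystem U m n)
    -- the metrics on `𝒫(U × Y)` and on `𝒫(𝒫(U × Y) × Z)`
    (ρ : D.FastMeas → D.FastMeas → ℝ) (hρ : SPAveraging.IsConsistentMetric ρ)
    (ρ' : D.SlowMeas → D.SlowMeas → ℝ) (hρ' : SPAveraging.IsConsistentMetric ρ')
    -- `f` is Lipschitz in the control
    (hfu : ∃ L : ℝ, ∀ u u', ∀ y ∈ D.Y, ∀ z ∈ D.Z, ‖D.f u y z - D.f u' y z‖ ≤ L * dist u u')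
    (S : D.Scheme)
    (pStar : D.SlowMeas) (μStar : ℝ → D.FastMeas) (zStar : ℝ → D.Z)
    (hopt : D.OptimalPair ρ pStar μStar zStar)
    (uStar : ℝ → ℝ → U) (yStar : ℝ → ℝ → D.Y)
    (hfast : D.OptimalFastPair μStar zStar uStar yStar)
    (y₀ : ℕ+ → ℕ+ → D.Z → D.Y) (μNM : ℕ+ → ℕ+ → D.Z → D.FastMeas)
    (zNM : ℕ+ → ℕ+ → D.Z → ℝ → D.Z) (lam : ℕ+ → ℕ+ → D.SlowMeas)
    (V : ℕ+ → ℕ+ → ℝ → Set D.Y) (O : ℕ+ → ℕ+ → Set D.Z)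
    (rate : C(U × D.Y × D.Z, ℝ) → ℝ → ℝ) (slowRate : C(D.FastMeas × D.Z, ℝ) → ℝ → ℝ)
    (hacg : S.GeneratesACG zStar yStar y₀ μNM zNM lam V O rate slowRate)
    (rQ : ℝ → ℝ) (hslow : D.SlowRegularity ρ zStar μNM zNM rQ)
    (rB : ℝ → ℝ → ℝ) (hreg : D.FastRegularity S zStar yStar rQ rB) :
    (∃ β : ℕ+ → ℕ+ → ℝ,
      (∀ N M, ∀ z₀ ∈ O N M, D.IsNearOptimalACG (β N M) z₀
        (S.famControl y₀ N M) (S.fam y₀ N M) (μNM N M) (zNM N M z₀)) ∧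
      SPAveraging.IterLimZero fun N M => ((β N M : ℝ) : EReal)) ∧
    SPAveraging.IterLimZero fun N M => ((ρ' (lam N M) pStar : ℝ) : EReal) := by
  have hO : ∀ N M, zStar 0 ∈ O N M := fun N M => mem_of_mem_nhds (hacg.mem_O N M 0 le_rfl)
  have hacg₀ := fun N M => hacg.acg N M _ (hO N M)
  have hocc := fun N M => hacg.slow_occupational N M _ (hO N M)
  have hμ := hacg.tendsto_occupational hρ hfu hopt hfast hslow.pos hreg
  have hconv := hslow.tendsto_avgTrajectory hρ hopt.admissible
    (fun N M => (hacg₀ N M).measurable_gTilde) (fun N M => (hacg₀ N M).trajectory) hμ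
  have hlam : Tendsto (fun p : ℕ+ × ℕ+ => lam p.1 p.2) SPAveraging.iterFilter (𝓝 pStar) :=
    SPAveraging.tendsto_occupationalMeasure (fun p => (hocc p.1 p.2).aemeasurable) hconv
      (fun h => ⟨slowRate h, hacg.slowRate_tendsto h, fun p T hT =>
        hacg.slowRate_bound h p.1 p.2 _ (hO _ _) T hT⟩) (hopt.isOccupationalMeasure S.approx_φ)
  -- The optimality gap depends on `lam N M` alone, hence not on `z₀`; the term `1/N` makes β
  -- strictly positive.
  refine ⟨⟨fun N M => |D.cost (lam N M) - D.VStar| + ((N : ℕ) : ℝ)⁻¹, fun N M z₀ hz₀ =>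
    ⟨by positivity, hacg.acg N M z₀ hz₀, D.cost (lam N M),
      (hacg.slow_occupational N M z₀ hz₀).tendsto ⟨_, D.continuous_GTilde⟩, ?_⟩, ?_⟩, ?_⟩
  · have h1 := le_abs_self (D.cost (lam N M) - D.VStar)
    have h2 : (0 : ℝ) ≤ ((N : ℕ) : ℝ)⁻¹ := by positivity
    linarith
  · rw [SPAveraging.iterLimZero_coe_iff fun N M => by positivity]
    have h1 : Tendsto (fun p : ℕ+ × ℕ+ => |D.cost (lam p.1 p.2) - D.VStar|)
        SPAveraging.iterFilter (𝓝 0) := by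
      have := (((D.continuous_cost.tendsto _).comp hlam).sub_const D.VStar).abs
      rwa [hopt.p_opt, ← hopt.values_eq, sub_self, abs_zero] at this
    have h2 : Tendsto (fun p : ℕ+ × ℕ+ => ((p.1 : ℕ) : ℝ)⁻¹) SPAveraging.iterFilter (𝓝 0) :=
      tendsto_inv_atTop_zero.comp (tendsto_natCast_atTop_atTop.comp
        (tendsto_PNat_val_atTop_atTop.comp (tendsto_fst.mono_left SPAveraging.iterFilter_le)))
    simpa using h1.add h2
  · rw [SPAveraging.iterLimZero_coe_iff fun N M => hρ'.nonneg _ _]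
    exact hρ'.tendsto_nhds_iff.1 hlam
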